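/- Let $f:\mathbb P^2\to\mathbb P^2$ be a holomorphic self-map of the complex projective plane of algebraic degree $d\ge 2$, i.e. $f=[P:Q:R]$ with $P,Q,R$ homogeneous polynomials of the same degree $d$ on $\mathbb C^3$ whose only common zero is $0$. Let $\check{\mathbb P}^2$ be the dual projective plane of lines in $\mathbb P^2$, and for $c\in\check{\mathbb P}^2$ let $\mathcal D c\subset\mathbb P^2$ be the corresponding line (likewise $\mathcal D$ denotes the inverse map from lines in $\mathbb P^2$ to points of $\check{\mathbb P}^2$). Let $C\subset\check{\mathbb P}^2$ be a reduced, irreducible algebraic curve and let $W_C$ be the algebraic web on $\mathbb P^2$ whose leaves are the lines $\mathcal D c$, $c\in C$. The web is called invariant under $f$ if for every $c\in C$ the image $f(\mathcal D c)$ is again a line of the web, and totally invariant under $f$ if for every $c\in C$ the preimage $f^{-1}(\mathcal D c)$ is a union of lines of the web. Then $W_C$ is invariant under $f$ if and only if it is totally invariant under $f$. Moreover, if $W_C$ is invariant and $g=\mathcal D\circ f\circ\mathcal D:C\to C$ is the induced map, i.e. $f(\mathcal D c)=\mathcal D g(c)$ for all $c\in C$, then: (i) $g:C\to C$ is a regular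 map (morphism of projective varieties) of topological degree $d$, i.e. every point of $C$ outside some finite set has exactly $d$ preimages under $g$; (ii) for every $c\in C$ we have $f_*(\mathcal D c)=d\cdot\mathcal D g(c)$ as divisors on $\mathbb P^2$, where the pushforward $f_*$ of divisors sends an irreducible curve $V$ to $\deg(f|_V:V\to f(V))\cdot f(V)$. -/

import Mathlib

noncomputable section

namespace PlaneWeb

open MvPolynomial
open scoped Matrix

/-- The complex projective plane `ℙ²`. -/
abbrev Plane : Type := Projectivization ℂ (Fin 3 → ℂ)

/-- The dual projective plane, in line coordinates: the point `[u : v : w]` stands for the line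
`u x + v y + w z = 0` in `ℙ²`. -/
abbrev DualPlane : Type := Projectivization ℂ (Fin 3 → ℂ)

/-- The value at `x ∈ ℂ³` of a triple of polynomials in three variables. -/
def evalVec (F : Fin 3 → MvPolynomial (Fin 3) ℂ) (x : Fin 3 → ℂ) : Fin 3 → ℂ :=
  fun i => eval x (F i)

/-- `f : ℙ² → ℙ²` is a holomorphic map of algebraic degree `d`: in homogeneous coordinates
`f = [P : Q : R]` with `P`, `Q`, `R` homogeneous of the same degree `d`, without common zero
in `ℂ³ \ {0}`. -/
def IsHolomorphicOfDegree (f : Plane → Plane) (d : ℕ) : Prop :=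
  ∃ F : Fin 3 → MvPolynomial (Fin 3) ℂ, (∀ i, (F i).IsHomogeneous d) ∧
    ∀ (x : Fin 3 → ℂ) (hx : x ≠ 0), ∃ hy : evalVec F x ≠ 0,
      f (Projectivization.mk ℂ x hx) = Projectivization.mk ℂ (evalVec F x) hy

/-- An irreducible (reduced) algebraic curve in a projective plane, given by its set of points:
the zero locus of an irreducible form. -/
def IsIrreducibleCurve (C : Set (Projectivization ℂ (Fin 3 → ℂ))) : Prop :=
  ∃ (F : MvPolynomial (Fin 3) ℂ) (n : ℕ), F.IsHomogeneous n ∧ Irreducible F ∧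
    ∀ (x : Fin 3 → ℂ) (hx : x ≠ 0), Projectivization.mk ℂ x hx ∈ C ↔ eval x F = 0

/-- The duality `𝒟` from points `c` of the dual plane to lines of `ℙ²`. -/
def dualLine (c : DualPlane) : Set Plane :=
  {p | Projectivization.orthogonal p c}

/-- A line of `ℙ²` comes from exactly one point of the dual plane. -/
theorem dualLine_injective : Function.Injective dualLine := by
  intro c c' h
  induction c using Projectivization.ind with | h v hv =>
  induction c' using Projectivization.ind with | h w hw =>
  rw [Projectivization.mk_eq_mk_iff_crossProduct_eq_zero]
  have key : ∀ a : Fin 3 → ℂ, a ⬝ᵥ (v ⨯₃ w) = 0 := by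
    intro a
    by_cases h0 : w ⨯₃ a = 0
    · have := triple_product_permutation a v w
      rw [this, h0, dotProduct_zero]
    · have h1 : Projectivization.mk ℂ (w ⨯₃ a) h0 ∈ dualLine (Projectivization.mk ℂ w hw) := by
        simp only [dualLine, Set.mem_ofPred_eq, Projectivization.orthogonal_mk]
        rw [dotProduct_comm]; exact dot_self_cross w a
      rw [← h] at h1
      simp only [dualLine, Set.mem_ofPred_eq, Projectivization.orthogonal_mk] at h1
      rw [triple_product_permutation a v w, dotProduct_comm]; exact h1
  funext i
  simpa using key (Pi.single i 1)

/-- The web given by `C` is invariant under `f`: the image of any line of the web is again a line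
of the web. -/
def WebInvariant (f : Plane → Plane) (C : Set DualPlane) : Prop :=
  ∀ c ∈ C, ∃ c' ∈ C, f '' dualLine c = dualLine c'

/-- The web given by `C` is totally invariant under `f`: the preimage of any line of the web is a
union of lines of the web. -/
def WebTotallyInvariant (f : Plane → Plane) (C : Set DualPlane) : Prop :=
  ∀ c ∈ C, ∃ S ⊆ C, f ⁻¹' dualLine c = ⋃ s ∈ S, dualLine s

/-- The induced selfmap `g = 𝒟 ∘ f ∘ 𝒟` of `C`: the point `g c` is the (unique) point of `C` whose
line is the image under `f` of the line of `c`. -/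
def inducedMap {f : Plane → Plane} {C : Set DualPlane} (h : WebInvariant f C) (c : C) : C :=
  ⟨(h c c.2).choose, (h c c.2).choose_spec.1⟩

theorem image_dualLine {f : Plane → Plane} {C : Set DualPlane} (h : WebInvariant f C) (c : C) :
    f '' dualLine c = dualLine (inducedMap h c) :=
  (h c c.2).choose_spec.2

/-- A regular map (morphism of projective varieties) between closed sets `X`, `Y` in the projective
plane: near each point of `X` it is given by three forms of the same degree that do not all vanish
at that point. -/
def IsRegularMap {X Y : Set (Projectivization ℂ (Fin 3 → ℂ))} (g : X → Y) : Prop :=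
  ∀ c₀ : X, ∃ (G : Fin 3 → MvPolynomial (Fin 3) ℂ) (n : ℕ), (∀ i, (G i).IsHomogeneous n) ∧
    (∀ (x : Fin 3 → ℂ) (hx : x ≠ 0), Projectivization.mk ℂ x hx = c₀ → evalVec G x ≠ 0) ∧
    ∀ (c : X) (x : Fin 3 → ℂ) (hx : x ≠ 0), Projectivization.mk ℂ x hx = c →
      ∀ hy : evalVec G x ≠ 0,
        (g c : Projectivization ℂ (Fin 3 → ℂ)) = Projectivization.mk ℂ (evalVec G x) hy

/-- A map between irreducible plane curves has topological degree `n`: a general point of the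
target, that is, any point outside some finite set, has exactly `n` preimages. -/
def HasTopologicalDegree {X Y : Set (Projectivization ℂ (Fin 3 → ℂ))} (g : X → Y) (n : ℕ) : Prop :=
  ∃ S : Set Y, S.Finite ∧ ∀ y ∉ S, (g ⁻¹' {y}).encard = n

/-- The topological degree as a number (it is unique if it exists, since curves are infinite). -/
def topologicalDegree {X Y : Set (Projectivization ℂ (Fin 3 → ℂ))} (g : X → Y) : ℕ :=
  sInf {n | HasTopologicalDegree g n}

/-- Prime divisors of `ℙ²`: irreducible curves. -/
def PrimeDivisor : Type := {V : Set Plane // IsIrreducibleCurve V}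

/-- Divisors on `ℙ²`: formal integer combinations of irreducible curves. -/
abbrev Divisor : Type := PrimeDivisor →₀ ℤ

open Classical in
/-- The pushforward of a prime divisor `V`: the curve `f(V)` with multiplicity the degree of
`f|_V : V → f(V)`, or zero if `f(V)` is not a curve. -/
def pushforwardPrime (f : Plane → Plane) (V : PrimeDivisor) : Divisor :=
  if h : IsIrreducibleCurve (f '' V.1) then
    Finsupp.single ⟨f '' V.1, h⟩ (topologicalDegree (Set.imageFactorization f V.1) : ℤ)
  else 0

/-- The pushforward `f_*` of divisors, extended additively from prime divisors. -/
def pushforward (f : Plane → Plane) : Divisor →+ Divisor :=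
  Finsupp.liftAddHom fun V => zmultiplesHom Divisor (pushforwardPrime f V)

/-- Lines are irreducible curves. -/
theorem isIrreducibleCurve_dualLine (c : DualPlane) : IsIrreducibleCurve (dualLine c) := by
  induction c using Projectivization.ind with | h v hv =>
  set F : MvPolynomial (Fin 3) ℂ := ∑ i, C (v i) * X i with hF
  have hom : F.IsHomogeneous 1 := by
    refine IsHomogeneous.sum _ _ _ fun i _ => ?_
    simpa using (isHomogeneous_C (Fin 3) (v i)).mul (isHomogeneous_X ℂ i)
  have hev : ∀ x : Fin 3 → ℂ, eval x F = x ⬝ᵥ v := by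
    intro x
    simp [hF, dotProduct, mul_comm]
  have hne : F ≠ 0 := by
    intro h0
    apply hv
    funext i
    have := hev (Pi.single i 1)
    rw [h0] at this
    simpa using this.symm
  refine ⟨F, 1, hom, ?_, ?_⟩
  · refine irreducible_of_totalDegree_eq_one (hom.totalDegree hne) fun a ha => ?_
    obtain ⟨m, hm⟩ := ne_zero_iff.mp hne
    exact isUnit_iff_ne_zero.mpr fun h0 => hm (by simpa [h0] using ha m)
  · intro x hx
    rw [hev]
    simp only [dualLine, Set.mem_ofPred_eq, Projectivization.orthogonal_mk]

/-- The line `𝒟 c`, as a divisor on `ℙ²`. -/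
def lineDivisor (c : DualPlane) : Divisor :=
  Finsupp.single (⟨dualLine c, isIrreducibleCurve_dualLine c⟩ : PrimeDivisor) 1

end PlaneWeb

end

/-!
Write `f` in homogeneous coordinates as a triple `F` of forms of degree `d` without common zero, and
let `H` be the irreducible form defining `C`. A line is a nonzero vector `u`, standing for the plane
`x ⬝ᵥ u = 0`, and `MapsLine F u c` says that `F` maps the plane of `u` into that of `c`. As two
binary forms without common zero define a surjective map of the projective line, the line of `u` is
then mapped onto that of `c`.

*Total invariance implies invariance.* That the image of the line `u` is a line of the web is a
polynomial condition on `u` (`lineImage`). It holds at infinitely many points of `C`, because every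
line of the web is the image of one and distinct lines come from distinct ones. An irreducible curve
meets a curve not containing it in finitely many points (`finite_inter_of_not_dvd`, by comparing
heights of prime ideals), so it holds at all points of `C`. The same polynomials show that the
induced map is regular.

*Invariance implies total invariance.* The directions at `x` of the lines of the web are the zeros
`v` of `H (x × v)`. Invariance makes `H (F x × DF x v)` vanish wherever `H (x × v)` does. Since the
polynomial `H (x × v)` is squarefree (`squarefree_crossForm`), it divides `H (F x × DF x v)`.
Both have the same degree in `v`, so for fixed `x` they are proportional, and where `DF x` is
invertible every line of the web through `F x` is the image of a line of the web through `x`. The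
Jacobian determinant is not identically zero by Sard's lemma, as `F` is surjective by Krull's height
theorem (`exists_common_zero`). The general point is a limit of such points, and lines of the web
through the approximating points accumulate (`isClosed_liftable`). If the web is a pencil and the
point lies over its base point, the approximation uses the finiteness of the fibres of `f` instead
(`mem_liftable_of_forall_cross`).

*Degrees.* By total invariance, the form defining `f⁻¹ (𝒟 c)` has the same zeros as the product of
the linear forms of the lines of the web mapped to `𝒟 c`. If it is squarefree it is this product, so
there are `d` such lines. If it is not, one of these lines lies in the critical curve, which happens
for finitely many `c`. On a line, `f` is a rational function of degree `d` of one variable, and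
all its fibres away from the zeros of a Wronskian are reduced.
-/

noncomputable section

namespace PlaneWeb

open MvPolynomial Topology Filter
open scoped Matrix

/-! ### Vectors of three-dimensional space -/

theorem exists_dotProduct_eq_one {u : Fin 3 → ℂ} (hu : u ≠ 0) : ∃ w, w ⬝ᵥ u = 1 := by
  obtain ⟨i, hi⟩ := Function.ne_iff.mp hu
  exact ⟨Pi.single i (u i)⁻¹, by simpa using inv_mul_cancel₀ hi⟩

theorem exists_cross_eq_of_dotProduct_eq_zero {u x : Fin 3 → ℂ} (hu : u ≠ 0) (h : x ⬝ᵥ u = 0) :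
    ∃ y, u ⨯₃ y = x := by
  obtain ⟨w, hw⟩ := exists_dotProduct_eq_one hu
  refine ⟨x ⨯₃ w, ?_⟩
  rw [cross_cross_eq_smul_sub_smul', h, dotProduct_comm u w, hw]
  simp

theorem exists_smul_eq_of_cross_eq_zero {u v : Fin 3 → ℂ} (hu : u ≠ 0) (h : u ⨯₃ v = 0) :
    ∃ t : ℂ, v = t • u := by
  obtain ⟨w, hw⟩ := exists_dotProduct_eq_one hu
  refine ⟨w ⬝ᵥ v, ?_⟩
  have := cross_cross_eq_smul_sub_smul' w u v
  rw [h, map_zero, dotProduct_comm u w, hw, one_smul] at this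
  exact (sub_eq_zero.mp this.symm).symm

/-- A vector orthogonal to `x` and to `y` is parallel to `x × y`. -/
theorem cross_cross_eq_zero {x y c : Fin 3 → ℂ} (hx : x ⬝ᵥ c = 0) (hy : y ⬝ᵥ c = 0) :
    c ⨯₃ (x ⨯₃ y) = 0 := by
  rw [cross_cross_eq_smul_sub_smul', dotProduct_comm c y, hy, hx]
  simp

theorem cross_smul_self (u : Fin 3 → ℂ) (t : ℂ) : u ⨯₃ (t • u) = 0 := by
  rw [map_smul, cross_self, smul_zero]

theorem exists_dotProduct_eq_zero (u : Fin 3 → ℂ) : ∃ x, x ≠ 0 ∧ x ⬝ᵥ u = 0 := by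
  by_cases h : u 0 = 0
  · exact ⟨Pi.single 0 1, by simp, by simpa using h⟩
  · refine ⟨![-u 1, u 0, 0], fun h0 => h (by simpa using congrFun h0 1), ?_⟩
    simp [dotProduct, Fin.sum_univ_three]
    ring

/-- The orthogonal complement of a nonzero vector is spanned by two vectors. -/
theorem exists_cross_ne_zero_of_dotProduct_eq_zero {u x : Fin 3 → ℂ} (hu : u ≠ 0) (hx : x ≠ 0)
    (h : x ⬝ᵥ u = 0) : ∃ y, y ⬝ᵥ u = 0 ∧ x ⨯₃ y ≠ 0 := by
  obtain ⟨z, hz⟩ := exists_dotProduct_eq_one hx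
  refine ⟨u ⨯₃ z, by rw [dotProduct_comm]; exact dot_self_cross u z, ?_⟩
  rw [cross_cross_eq_smul_sub_smul', dotProduct_comm x z, hz, dotProduct_comm u x, h]
  simpa using hu

/-! ### Forms restricted to an affine line -/

theorem eval_smul_of_isHomogeneous {σ : Type*} {φ : MvPolynomial σ ℂ} {n : ℕ}
    (h : φ.IsHomogeneous n) (t : ℂ) (x : σ → ℂ) : eval (t • x) φ = t ^ n * eval x φ := by
  rw [eval_eq, eval_eq, Finset.mul_sum]
  refine Finset.sum_congr rfl fun m hm => ?_
  have hd : ∑ i ∈ m.support, m i = n := by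
    rw [← h.degree_eq_sum_deg_support hm]
  simp only [Pi.smul_apply, smul_eq_mul, mul_pow, Finset.prod_mul_distrib,
    Finset.prod_pow_eq_pow_sum, hd]
  ring

/-- The restriction of `φ` to the line `z ↦ x + z a`, as a polynomial in `z`. -/
def lineRestrict (φ : MvPolynomial (Fin 3) ℂ) (x a : Fin 3 → ℂ) : Polynomial ℂ :=
  aeval (fun i => Polynomial.C (x i) + Polynomial.C (a i) * Polynomial.X) φ

theorem eval_lineRestrict (φ : MvPolynomial (Fin 3) ℂ) (x a : Fin 3 → ℂ) (z : ℂ) :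
    (lineRestrict φ x a).eval z = eval (x + z • a) φ := by
  unfold lineRestrict
  induction φ using MvPolynomial.induction_on with
  | C c => simp
  | add p q hp hq => rw [map_add, map_add, Polynomial.eval_add, hp, hq]
  | mul_X p i hp =>
    rw [map_mul, map_mul, Polynomial.eval_mul, hp, aeval_X, eval_X, Polynomial.eval_add,
      Polynomial.eval_mul, Polynomial.eval_C, Polynomial.eval_C, Polynomial.eval_X, Pi.add_apply,
      Pi.smul_apply, smul_eq_mul, mul_comm z]

/-- A form of degree `n` restricts to a polynomial of degree at most `n` on a line; its coefficient
of degree `n` is the value of the form in the direction of the line. -/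
theorem natDegree_lineRestrict_le_and_coeff {φ : MvPolynomial (Fin 3) ℂ} {n : ℕ}
    (h : φ.IsHomogeneous n) (x a : Fin 3 → ℂ) :
    (lineRestrict φ x a).natDegree ≤ n ∧ (lineRestrict φ x a).coeff n = eval a φ := by
  have key : ∀ m ∈ φ.support,
      (Polynomial.C (φ.coeff m) *
        ∏ i, (Polynomial.C (x i) + Polynomial.C (a i) * Polynomial.X) ^ m i).natDegree ≤ n ∧
      (Polynomial.C (φ.coeff m) *
        ∏ i, (Polynomial.C (x i) + Polynomial.C (a i) * Polynomial.X) ^ m i).coeff n =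
        φ.coeff m * ∏ i, a i ^ m i := by
    intro m hm
    have hd : m 0 + m 1 + m 2 = n := by
      rw [h.degree_eq_sum_deg_support hm]
      exact ((Finsupp.degree_eq_sum m).trans (Fin.sum_univ_three _)).symm
    have h1 : ∀ i, (Polynomial.C (x i) + Polynomial.C (a i) * Polynomial.X).natDegree ≤ 1 := by
      intro i; compute_degree
    have hp : ∀ i, ((Polynomial.C (x i) + Polynomial.C (a i) * Polynomial.X) ^ m i).natDegree
        ≤ m i := fun i => by
      simpa using Polynomial.natDegree_pow_le_of_le (m i) (h1 i)
    have hc : ∀ i, ((Polynomial.C (x i) + Polynomial.C (a i) * Polynomial.X) ^ m i).coeff (m i)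
        = a i ^ m i := fun i => by
      have := Polynomial.coeff_pow_of_natDegree_le (m := m i) (h1 i)
      simpa using this
    rw [Fin.prod_univ_three, Fin.prod_univ_three, ← hd]
    have h01 := Polynomial.natDegree_mul_le_of_le (hp 0) (hp 1)
    refine ⟨(Polynomial.natDegree_C_mul_le _ _).trans
      (Polynomial.natDegree_mul_le_of_le h01 (hp 2)), ?_⟩
    rw [Polynomial.coeff_C_mul, Polynomial.coeff_mul_add_eq_of_natDegree_le h01 (hp 2),
      Polynomial.coeff_mul_add_eq_of_natDegree_le (hp 0) (hp 1), hc, hc, hc]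
  have hexp : lineRestrict φ x a = ∑ m ∈ φ.support, Polynomial.C (φ.coeff m) *
      ∏ i, (Polynomial.C (x i) + Polynomial.C (a i) * Polynomial.X) ^ m i := by
    rw [lineRestrict, aeval_def, eval₂_eq']
    rfl
  rw [hexp]
  refine ⟨Polynomial.natDegree_sum_le_of_forall_le _ _ fun m hm => (key m hm).1, ?_⟩
  rw [Polynomial.finsetSum_coeff, eval_eq']
  exact Finset.sum_congr rfl fun m hm => (key m hm).2

/-- A form that does not vanish at `a` has a zero on every line of direction `a`, and one that is
close to `x` if the value at `x` is small. -/
theorem exists_root_on_line {φ : MvPolynomial (Fin 3) ℂ} {n : ℕ} (h : φ.IsHomogeneous n)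
    (hn : 0 < n) (x : Fin 3 → ℂ) {a : Fin 3 → ℂ} (ha : eval a φ ≠ 0) :
    ∃ z : ℂ, eval (x + z • a) φ = 0 ∧ ‖z‖ ^ n * ‖eval a φ‖ ≤ ‖eval x φ‖ := by
  obtain ⟨h1, h2⟩ := natDegree_lineRestrict_le_and_coeff h x a
  set p := lineRestrict φ x a with hp
  have hdeg : p.natDegree = n := le_antisymm h1 (Polynomial.le_natDegree_of_ne_zero (by rwa [h2]))
  have hlead : p.leadingCoeff = eval a φ := by rw [Polynomial.leadingCoeff, hdeg, h2]
  have hp0 : p ≠ 0 := fun h0 => ha (by rw [← hlead, h0, Polynomial.leadingCoeff_zero])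
  have hs := IsAlgClosed.splits p
  by_contra! hcon
  have hroots : ∀ z ∈ p.roots, ‖eval x φ‖ < ‖z‖ ^ n * ‖eval a φ‖ := fun z hz =>
    hcon z (by rw [← eval_lineRestrict]; exact (Polynomial.mem_roots hp0).mp hz)
  have hprod : ‖eval x φ‖ = ‖eval a φ‖ * (p.roots.map (‖·‖)).prod := by
    have h0 : p.coeff 0 = eval x φ := by
      rw [Polynomial.coeff_zero_eq_eval_zero, hp, eval_lineRestrict]; simp
    rw [← h0, hs.coeff_zero_eq_leadingCoeff_mul_prod_roots, hlead]
    rw [norm_mul, norm_mul, norm_pow, norm_neg, norm_one, one_pow, one_mul]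
    exact congrArg _ (map_multiset_prod (normHom : ℂ →*₀ ℝ) p.roots)
  have hcard : Multiset.card p.roots = n := by rw [← hs.natDegree_eq_card_roots, hdeg]
  have ha' : 0 < ‖eval a φ‖ := norm_pos_iff.mpr ha
  -- the product of the roots is `± φ x / φ a`, so the smallest root satisfies the bound
  obtain ⟨r, hr, hmin⟩ : ∃ r ∈ p.roots, ∀ z ∈ p.roots, ‖r‖ ≤ ‖z‖ := by
    obtain ⟨r, hr, hmin⟩ := Finset.exists_min_image p.roots.toFinset (‖·‖) (by
      rw [Multiset.toFinset_nonempty]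
      intro h0
      rw [h0] at hcard
      simp at hcard
      omega)
    exact ⟨r, by simpa using hr, fun z hz => hmin z (by simpa using hz)⟩
  have hpow : ∀ s : Multiset ℂ, (∀ z ∈ s, ‖r‖ ≤ ‖z‖) →
      ‖r‖ ^ Multiset.card s ≤ (s.map (‖·‖)).prod := by
    intro s
    induction s using Multiset.induction_on with
    | empty => simp
    | cons z s ih =>
      intro hz
      rw [Multiset.card_cons, Multiset.map_cons, Multiset.prod_cons, pow_succ']
      exact mul_le_mul (hz z (by simp)) (ih fun y hy => hz y (by simp [hy])) (by positivity)
        (norm_nonneg _)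
  have h3 := hpow _ hmin
  rw [hcard] at h3
  have h4 := hroots r hr
  rw [hprod, mul_comm (‖r‖ ^ n)] at h4
  exact absurd (lt_of_mul_lt_mul_left h4 ha'.le) (not_lt.mpr h3)

/-! ### Derivatives of polynomials -/

theorem hasFDerivAt_eval (φ : MvPolynomial (Fin 3) ℂ) (x : Fin 3 → ℂ) :
    HasFDerivAt (fun y : Fin 3 → ℂ => eval y φ)
      (∑ i, eval x (pderiv i φ) • ContinuousLinearMap.proj (R := ℂ) (φ := fun _ : Fin 3 => ℂ) i)
      x := by
  induction φ using MvPolynomial.induction_on with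
  | C c =>
    have h := hasFDerivAt_const (𝕜 := ℂ) (F := ℂ) c x
    simp only [eval_C]
    refine h.congr_fderiv ?_
    ext v
    simp [sum_apply]
  | add p q hp hq =>
    have h := hp.fun_add hq
    simp only [map_add]
    refine h.congr_fderiv ?_
    ext v
    simp [sum_apply, add_mul, Finset.sum_add_distrib]
  | mul_X p j hp =>
    have h := hp.mul ((ContinuousLinearMap.proj (R := ℂ) (φ := fun _ : Fin 3 => ℂ) j).hasFDerivAt
      (x := x))
    simp only [map_mul, eval_X]
    refine h.congr_fderiv ?_
    ext v
    simp only [Derivation.leibniz, pderiv_X, ContinuousLinearMap.proj_apply, smul_eq_mul,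
      add_apply, smul_apply, map_add, map_mul, eval_X,
      sum_apply, add_mul, Finset.sum_add_distrib, Finset.mul_sum]
    congr 1
    · rw [Finset.sum_eq_single j]
      · simp
      · intro b _ hb
        simp [hb.symm]
      · simp
    · exact Finset.sum_congr rfl fun i _ => by ring

theorem eval_derivative_lineRestrict (φ : MvPolynomial (Fin 3) ℂ) (x a : Fin 3 → ℂ) (z : ℂ) :
    (Polynomial.derivative (lineRestrict φ x a)).eval z =
      ∑ i, eval (x + z • a) (pderiv i φ) * a i := by
  have h1 := (lineRestrict φ x a).hasDerivAt z
  have h2 : HasDerivAt (fun z : ℂ => x + z • a) a z := by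
    simpa using ((hasDerivAt_id z).smul_const a).const_add x
  have h3 := (hasFDerivAt_eval φ (x + z • a)).comp_hasDerivAt z h2
  have h4 : (fun y => eval y φ) ∘ (fun z : ℂ => x + z • a) =
      fun z => (lineRestrict φ x a).eval z := by
    funext z; simp [eval_lineRestrict]
  rw [h4] at h3
  rw [h1.unique h3]
  simp

/-- The Jacobian matrix at `x` of a triple of polynomials. -/
def jacobian (F : Fin 3 → MvPolynomial (Fin 3) ℂ) (x : Fin 3 → ℂ) : Matrix (Fin 3) (Fin 3) ℂ :=
  Matrix.of fun i j => eval x (pderiv j (F i))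

/-- The Jacobian determinant of a triple of polynomials, as a polynomial. -/
def jacobianDet (F : Fin 3 → MvPolynomial (Fin 3) ℂ) : MvPolynomial (Fin 3) ℂ :=
  (Matrix.of fun i j => pderiv j (F i)).det

theorem eval_jacobianDet (F : Fin 3 → MvPolynomial (Fin 3) ℂ) (x : Fin 3 → ℂ) :
    eval x (jacobianDet F) = (jacobian F x).det := by
  rw [jacobianDet, RingHom.map_det]
  rfl

/-! ### Common zeros of polynomials in three variables -/

/-- The linear form `x ↦ x ⬝ᵥ v`. -/
def linForm (v : Fin 3 → ℂ) : MvPolynomial (Fin 3) ℂ := ∑ i, C (v i) * X i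

theorem eval_linForm (v x : Fin 3 → ℂ) : eval x (linForm v) = x ⬝ᵥ v := by
  simp [linForm, dotProduct, mul_comm]

/-- Nullstellensatz for principal ideals. -/
theorem exists_dvd_pow_of_forall_eval_eq_zero {σ : Type*} [Finite σ] {A B : MvPolynomial σ ℂ}
    (h : ∀ x, eval x A = 0 → eval x B = 0) : ∃ N, A ∣ B ^ N := by
  have : B ∈ (Ideal.span {A}).radical := by
    rw [← vanishingIdeal_zeroLocus_eq_radical (K := ℂ)]
    intro x hx
    exact h x (hx A (Ideal.mem_span_singleton_self A))
  obtain ⟨N, hN⟩ := this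
  exact ⟨N, Ideal.mem_span_singleton.mp hN⟩

/-- The prime ideal of the origin of `ℂ³`. -/
def originIdeal : Ideal (MvPolynomial (Fin 3) ℂ) := RingHom.ker (eval (0 : Fin 3 → ℂ))

/-- The prime ideal of the line through the origin and `p` in `ℂ³`. -/
def lineIdeal (p : Fin 3 → ℂ) : Ideal (MvPolynomial (Fin 3) ℂ) :=
  RingHom.ker ((aeval fun i => Polynomial.C (p i) * Polynomial.X :
    MvPolynomial (Fin 3) ℂ →ₐ[ℂ] Polynomial ℂ))

instance : originIdeal.IsPrime := RingHom.ker_isPrime _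

instance (p : Fin 3 → ℂ) : (lineIdeal p).IsPrime := RingHom.ker_isPrime _

theorem mem_originIdeal {G : MvPolynomial (Fin 3) ℂ} : G ∈ originIdeal ↔ eval 0 G = 0 :=
  RingHom.mem_ker

theorem mem_lineIdeal {p : Fin 3 → ℂ} {G : MvPolynomial (Fin 3) ℂ} :
    G ∈ lineIdeal p ↔ ∀ t : ℂ, eval (t • p) G = 0 := by
  have h : aeval (fun i => Polynomial.C (p i) * Polynomial.X) G = lineRestrict G 0 p := by
    simp [lineRestrict]
  rw [lineIdeal, RingHom.mem_ker, h]
  constructor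
  · intro h0 t
    simpa [h0] using (eval_lineRestrict G 0 p t).symm
  · intro h0
    refine Polynomial.funext fun t => ?_
    rw [eval_lineRestrict, zero_add, h0, Polynomial.eval_zero]

theorem linForm_mem_lineIdeal {p v : Fin 3 → ℂ} : linForm v ∈ lineIdeal p ↔ p ⬝ᵥ v = 0 := by
  rw [mem_lineIdeal]
  simp only [eval_linForm, smul_dotProduct, smul_eq_mul]
  exact ⟨fun h => by simpa using h 1, fun h t => by rw [h, mul_zero]⟩

theorem cross_eq_zero_of_lineIdeal_eq {p q : Fin 3 → ℂ} (h : lineIdeal p = lineIdeal q) :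
    p ⨯₃ q = 0 := by
  rw [← dotProduct_eq_zero_iff]
  intro w
  have h1 : linForm (w ⨯₃ p) ∈ lineIdeal p := linForm_mem_lineIdeal.mpr (dot_cross_self w p)
  rw [h, linForm_mem_lineIdeal] at h1
  rw [dotProduct_comm, triple_product_permutation, triple_product_permutation]
  exact h1

theorem lineIdeal_lt_originIdeal {p : Fin 3 → ℂ} (hp : p ≠ 0) : lineIdeal p < originIdeal := by
  refine lt_of_le_of_ne (fun G hG => ?_) fun h => ?_
  · rw [mem_originIdeal, ← zero_smul ℂ p]
    exact mem_lineIdeal.mp hG 0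
  · obtain ⟨w, hw⟩ := exists_dotProduct_eq_one hp
    have h1 : linForm w ∈ originIdeal := by rw [mem_originIdeal, eval_linForm]; simp
    rw [← h, linForm_mem_lineIdeal, dotProduct_comm, hw] at h1
    exact one_ne_zero h1

theorem succ_le_height_of_lt {R : Type*} [CommRing R] {I J : Ideal R} [I.IsPrime] [J.IsPrime]
    (h : I < J) {n : ℕ} (hn : (n : ℕ∞) ≤ I.height) : ((n + 1 : ℕ) : ℕ∞) ≤ J.height := by
  push_cast
  exact (by gcongr : (n : ℕ∞) + 1 ≤ I.height + 1).trans
    (Ideal.height_add_one_le_of_lt_of_isPrime h)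

theorem height_originIdeal_le : originIdeal.height ≤ 3 := by
  have h := Ideal.height_le_ringKrullDim_of_isPrime (I := originIdeal)
  rw [MvPolynomial.ringKrullDim_of_isNoetherianRing, ringKrullDim_eq_zero_of_field] at h
  simp only [Nat.card_eq_fintype_card, Fintype.card_fin, zero_add] at h
  exact WithBot.coe_le_coe.mp h

theorem three_le_height_originIdeal : 3 ≤ originIdeal.height := by
  -- the chain of the zero ideal, a coordinate plane, a coordinate axis and the origin
  let π : MvPolynomial (Fin 3) ℂ →ₐ[ℂ] MvPolynomial (Fin 3) ℂ := aeval ![X 0, X 1, 0]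
  have hπ : (RingHom.ker π).IsPrime := RingHom.ker_isPrime _
  let e : Fin 3 → ℂ := Pi.single 0 1
  have he : e ≠ 0 := by simp [e]
  have h1 : (⊥ : Ideal (MvPolynomial (Fin 3) ℂ)) < RingHom.ker π := by
    rw [bot_lt_iff_ne_bot, Submodule.ne_bot_iff]
    exact ⟨X 2, by simp [π], X_ne_zero 2⟩
  have h2 : RingHom.ker π < lineIdeal e := by
    refine lt_of_le_of_ne (fun G hG => mem_lineIdeal.mpr fun t => ?_) fun h => ?_
    · have h3 : eval (t • e) (π G) = 0 := by rw [RingHom.mem_ker.mp hG, map_zero]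
      have h4 : eval (t • e) (π G) = eval (t • e) G := by
        have h5 : ((eval (t • e)).comp (π : MvPolynomial (Fin 3) ℂ →+* _)) = eval (t • e) := by
          ext i
          · simp [π]
          · fin_cases i <;> simp [π, e]
        exact congrArg (fun g => g G) h5
      rw [← h4, h3]
    · have h3 : linForm (Pi.single 1 1) ∈ lineIdeal e := by
        rw [linForm_mem_lineIdeal]; simp [e]
      rw [← h, RingHom.mem_ker] at h3
      have h4 := congrArg (eval (Pi.single 1 1 : Fin 3 → ℂ)) h3
      simp [linForm, π, Fin.sum_univ_three] at h4
  exact succ_le_height_of_lt (lineIdeal_lt_originIdeal he) (succ_le_height_of_lt h2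
    (succ_le_height_of_lt h1 (n := 0) (by simp)))

/-- An ideal whose only zero is the origin has the origin as a minimal prime. -/
theorem originIdeal_mem_minimalPrimes {I : Ideal (MvPolynomial (Fin 3) ℂ)} (hI : I ≤ originIdeal)
    (h : ∀ x : Fin 3 → ℂ, (∀ G ∈ I, eval x G = 0) → x = 0) : originIdeal ∈ I.minimalPrimes := by
  refine ⟨⟨inferInstance, hI⟩, fun P hP _ => ?_⟩
  have := hP.1
  rw [← IsPrime.vanishingIdeal_zeroLocus (K := ℂ) P]
  intro G hG x hx
  rw [h x fun A hA => hx A (hP.2 hA)]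
  exact hG

/-- Two polynomials in three variables that vanish at the origin have another common zero, by
Krull's height theorem. -/
theorem exists_common_zero {G₁ G₂ : MvPolynomial (Fin 3) ℂ} (h₁ : eval 0 G₁ = 0)
    (h₂ : eval 0 G₂ = 0) : ∃ x : Fin 3 → ℂ, x ≠ 0 ∧ eval x G₁ = 0 ∧ eval x G₂ = 0 := by
  by_contra! hcon
  have hmin : originIdeal ∈ (Ideal.span {G₁, G₂}).minimalPrimes := by
    refine originIdeal_mem_minimalPrimes ?_ fun x hx => ?_
    · rw [Ideal.span_le]
      rintro G (rfl | rfl)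
      exacts [mem_originIdeal.mpr h₁, mem_originIdeal.mpr h₂]
    · by_contra h0
      exact hcon x h0 (hx _ (Ideal.subset_span (by simp))) (hx _ (Ideal.subset_span (by simp)))
  have h := Ideal.height_le_card_of_mem_minimalPrimes_span (Set.toFinite _) hmin
  have h3 := three_le_height_originIdeal.trans h
  have h4 : ({G₁, G₂} : Set (MvPolynomial (Fin 3) ℂ)).ncard ≤ 2 :=
    (Set.ncard_insert_le _ _).trans (by simp)
  have h5 : 3 ≤ ({G₁, G₂} : Set (MvPolynomial (Fin 3) ℂ)).ncard := by exact_mod_cast h3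
  omega

/-- If every line through the origin on which `I` vanishes is a minimal prime of `I`, there are
only finitely many such lines. -/
theorem finite_of_lineIdeal_mem_minimalPrimes {I : Ideal (MvPolynomial (Fin 3) ℂ)}
    {S : Set (Projectivization ℂ (Fin 3 → ℂ))}
    (h : ∀ P ∈ S, lineIdeal P.rep ∈ I.minimalPrimes) : S.Finite := by
  refine Set.Finite.of_finite_image (f := fun P => lineIdeal P.rep)
    ((Ideal.finite_minimalPrimes_of_isNoetherianRing _ I).subset ?_) ?_
  · rintro _ ⟨P, hP, rfl⟩
    exact h P hP
  · intro P _ Q _ hPQ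
    rw [← P.mk_rep, ← Q.mk_rep, Projectivization.mk_eq_mk_iff_crossProduct_eq_zero]
    exact cross_eq_zero_of_lineIdeal_eq hPQ

/-- An irreducible plane curve and a curve not containing it meet in finitely many points. -/
theorem finite_inter_of_not_dvd {H G : MvPolynomial (Fin 3) ℂ} (hH : Irreducible H)
    (hG : ¬ H ∣ G) :
    {P : Projectivization ℂ (Fin 3 → ℂ) | H ∈ lineIdeal P.rep ∧ G ∈ lineIdeal P.rep}.Finite := by
  refine finite_of_lineIdeal_mem_minimalPrimes (I := Ideal.span {H, G}) fun P hP => ?_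
  refine ⟨⟨inferInstance, ?_⟩, fun Q hQ hQP => ?_⟩
  · rw [Ideal.span_le]
    rintro A (rfl | rfl)
    exacts [hP.1, hP.2]
  · have := hQ.1
    have hHp : (Ideal.span {H}).IsPrime :=
      (Ideal.span_singleton_prime hH.ne_zero).mpr hH.prime
    have h1 : (⊥ : Ideal (MvPolynomial (Fin 3) ℂ)) < Ideal.span {H} := by
      rw [bot_lt_iff_ne_bot, Ne, Ideal.span_singleton_eq_bot]
      exact hH.ne_zero
    have h2 : Ideal.span {H} < Q := by
      refine lt_of_le_of_ne ((Ideal.span_mono (by simp)).trans hQ.2) fun h => hG ?_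
      rw [← Ideal.mem_span_singleton, h]
      exact hQ.2 (Ideal.subset_span (by simp))
    have h4 := lineIdeal_lt_originIdeal P.rep_nonzero
    by_contra hne
    -- otherwise `⊥ < (H) < Q < lineIdeal < originIdeal` contradicts `height_originIdeal_le`
    have h3 : Q < lineIdeal P.rep := lt_of_le_not_ge hQP hne
    have h5 := (succ_le_height_of_lt h4 (succ_le_height_of_lt h3 (succ_le_height_of_lt h2
      (succ_le_height_of_lt h1 (n := 0) (by simp))))).trans height_originIdeal_le
    exact absurd h5 (by norm_num)

/-- Two polynomials that have only the origin in common with a third one have only finitely many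
projective zeros in common. -/
theorem finite_of_common_zero_eq_zero {G₁ G₂ G₃ : MvPolynomial (Fin 3) ℂ} (h₃ : eval 0 G₃ = 0)
    (h : ∀ x : Fin 3 → ℂ, eval x G₁ = 0 → eval x G₂ = 0 → eval x G₃ = 0 → x = 0) :
    {P : Projectivization ℂ (Fin 3 → ℂ) | G₁ ∈ lineIdeal P.rep ∧ G₂ ∈ lineIdeal P.rep}.Finite := by
  refine finite_of_lineIdeal_mem_minimalPrimes (I := Ideal.span {G₁, G₂}) fun P hP => ?_
  refine ⟨⟨inferInstance, ?_⟩, fun Q hQ hQP => ?_⟩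
  · rw [Ideal.span_le]
    rintro A (rfl | rfl)
    exacts [hP.1, hP.2]
  · have := hQ.1
    have h4 := lineIdeal_lt_originIdeal P.rep_nonzero
    by_contra hne
    have h3 : Q < lineIdeal P.rep := lt_of_le_not_ge hQP hne
    have hmin : originIdeal ∈ (Q ⊔ Ideal.span {G₃}).minimalPrimes := by
      refine originIdeal_mem_minimalPrimes (sup_le (hQP.trans h4.le) ?_) fun x hx => ?_
      · rw [Ideal.span_singleton_le_iff_mem]
        exact mem_originIdeal.mpr h₃
      · exact h x (hx _ (Ideal.mem_sup_left (hQ.2 (Ideal.subset_span (by simp)))))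
          (hx _ (Ideal.mem_sup_left (hQ.2 (Ideal.subset_span (by simp)))))
          (hx _ (Ideal.mem_sup_right (Ideal.mem_span_singleton_self _)))
    -- modulo `Q` the origin is minimal over the image of `G₃`, so its height is at most `1`
    have h1 := Ideal.map_height_le_one_of_mem_minimalPrimes hmin
    have hs : Function.Surjective (Ideal.Quotient.mk Q) := Ideal.Quotient.mk_surjective
    have hk : RingHom.ker (Ideal.Quotient.mk Q) = Q := Ideal.mk_ker
    have hc : ∀ J : Ideal (MvPolynomial (Fin 3) ℂ), Q ≤ J →
        (J.map (Ideal.Quotient.mk Q)).comap (Ideal.Quotient.mk Q) = J := fun J hJ => by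
      rw [Ideal.comap_map_of_surjective _ hs, ← RingHom.ker_eq_comap_bot, hk, sup_eq_left.mpr hJ]
    have p1 : ((lineIdeal P.rep).map (Ideal.Quotient.mk Q)).IsPrime :=
      Ideal.map_isPrime_of_surjective hs (hk.trans_le hQP)
    have p2 : (originIdeal.map (Ideal.Quotient.mk Q)).IsPrime :=
      Ideal.map_isPrime_of_surjective hs (hk.trans_le (hQP.trans h4.le))
    have l1 : (⊥ : Ideal (MvPolynomial (Fin 3) ℂ ⧸ Q)) <
        (lineIdeal P.rep).map (Ideal.Quotient.mk Q) := by
      refine lt_of_le_of_ne bot_le fun h => h3.ne ?_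
      rw [← hc _ hQP, ← h, ← RingHom.ker_eq_comap_bot, hk]
    have l2 : (lineIdeal P.rep).map (Ideal.Quotient.mk Q) <
        originIdeal.map (Ideal.Quotient.mk Q) := by
      refine lt_of_le_of_ne (Ideal.map_mono h4.le) fun h => h4.ne ?_
      rw [← hc _ hQP, h, hc _ (hQP.trans h4.le)]
    have h5 := (succ_le_height_of_lt l2
      (succ_le_height_of_lt l1 (n := 0) (by simp))).trans h1
    exact absurd h5 (by norm_num)

/-! ### Non-vanishing of the Jacobian determinant -/

theorem hasFDerivAt_evalVec (F : Fin 3 → MvPolynomial (Fin 3) ℂ) (x : Fin 3 → ℂ) :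
    HasFDerivAt (evalVec F) (LinearMap.toContinuousLinearMap (Matrix.toLin' (jacobian F x))) x := by
  rw [hasFDerivAt_pi']
  intro i
  refine (hasFDerivAt_eval (F i) x).congr_fderiv ?_
  ext v
  simp [sum_apply, jacobian, Matrix.mulVec, dotProduct]

/-- By Sard's lemma, a surjective polynomial map has a nonzero Jacobian determinant. -/
theorem jacobianDet_ne_zero_of_surjective {F : Fin 3 → MvPolynomial (Fin 3) ℂ}
    (hF : Function.Surjective (evalVec F)) : jacobianDet F ≠ 0 := by
  intro h0
  have hzero := MeasureTheory.addHaar_image_eq_zero_of_det_fderivWithin_eq_zero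
    (MeasureTheory.Measure.addHaar : MeasureTheory.Measure (Fin 3 → ℂ)) (s := Set.univ)
    (fun x _ => ((hasFDerivAt_evalVec F x).restrictScalars ℝ).hasFDerivWithinAt) fun x _ => by
      have hx : (jacobian F x).det = 0 := by rw [← eval_jacobianDet, h0, map_zero]
      obtain ⟨v, hv, hJ⟩ := Matrix.exists_mulVec_eq_zero_iff.mpr hx
      by_contra hdet
      -- a nonzero real determinant would make the complex derivative injective
      refine hv ((LinearMap.equivOfDetNeZero _ hdet).injective ?_)
      rw [map_zero]
      exact hJ
  rw [Set.image_univ, hF.range_eq] at hzero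
  exact (MeasureTheory.Measure.measure_univ_ne_zero.mpr
    (NeZero.ne (MeasureTheory.Measure.addHaar : MeasureTheory.Measure (Fin 3 → ℂ)))) hzero

/-! ### Holomorphic self-maps of the plane in homogeneous coordinates -/

/-- `F` is a triple of forms of degree `d > 0` without common zero outside the origin. -/
structure IsNondegenerate (F : Fin 3 → MvPolynomial (Fin 3) ℂ) (d : ℕ) : Prop where
  isHomogeneous : ∀ i, (F i).IsHomogeneous d
  evalVec_ne_zero : ∀ x : Fin 3 → ℂ, x ≠ 0 → evalVec F x ≠ 0
  pos : 0 < d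

/-- The pullback under `F` of the linear form with coefficients `c`: the equation of the preimage
of the line with coordinates `c`. -/
def pullback (F : Fin 3 → MvPolynomial (Fin 3) ℂ) (c : Fin 3 → ℂ) : MvPolynomial (Fin 3) ℂ :=
  ∑ i, C (c i) * F i

/-- `F` maps the plane orthogonal to `u` into the plane orthogonal to `c`. -/
def MapsLine (F : Fin 3 → MvPolynomial (Fin 3) ℂ) (u c : Fin 3 → ℂ) : Prop :=
  ∀ x, x ⬝ᵥ u = 0 → evalVec F x ⬝ᵥ c = 0

theorem eval_pullback (F : Fin 3 → MvPolynomial (Fin 3) ℂ) (c x : Fin 3 → ℂ) :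
    eval x (pullback F c) = evalVec F x ⬝ᵥ c := by
  simp [pullback, evalVec, dotProduct, mul_comm]

theorem eval_derivative_lineRestrict_pullback (F : Fin 3 → MvPolynomial (Fin 3) ℂ)
    (c x a : Fin 3 → ℂ) (z : ℂ) :
    (Polynomial.derivative (lineRestrict (pullback F c) x a)).eval z =
      (jacobian F (x + z • a) *ᵥ a) ⬝ᵥ c := by
  rw [eval_derivative_lineRestrict]
  simp only [pullback, map_sum, Derivation.leibniz, pderiv_C, smul_eq_mul, mul_zero, add_zero,
    map_mul, eval_C, jacobian, dotProduct, Matrix.mulVec, Matrix.of_apply, Finset.sum_mul]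
  rw [Finset.sum_comm]
  exact Finset.sum_congr rfl fun i _ => Finset.sum_congr rfl fun j _ => by ring

theorem MapsLine.jacobian_mulVec {F : Fin 3 → MvPolynomial (Fin 3) ℂ} {u c q v : Fin 3 → ℂ}
    (h : MapsLine F u c) (hq : q ⬝ᵥ u = 0) (hv : v ⬝ᵥ u = 0) :
    (jacobian F q *ᵥ v) ⬝ᵥ c = 0 := by
  have h0 : lineRestrict (pullback F c) q v = 0 := by
    refine Polynomial.funext fun z => ?_
    rw [eval_lineRestrict, eval_pullback, Polynomial.eval_zero]
    exact h _ (by rw [add_dotProduct, smul_dotProduct, hq, hv, smul_zero, add_zero])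
  simpa [h0] using (eval_derivative_lineRestrict_pullback F c q v 0).symm

theorem MapsLine.smul_left {F : Fin 3 → MvPolynomial (Fin 3) ℂ} {u c : Fin 3 → ℂ}
    (h : MapsLine F u c) {t : ℂ} (ht : t ≠ 0) : MapsLine F (t • u) c := fun x hx =>
  h x (by rw [dotProduct_smul] at hx; exact (smul_eq_zero.mp hx).resolve_left ht)

theorem MapsLine.smul_right {F : Fin 3 → MvPolynomial (Fin 3) ℂ} {u c : Fin 3 → ℂ}
    (h : MapsLine F u c) (t : ℂ) : MapsLine F u (t • c) := fun x hx => by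
  rw [dotProduct_smul, h x hx, smul_zero]

theorem exists_smul_of_mk_eq {u v : Fin 3 → ℂ} {hu : u ≠ 0} {hv : v ≠ 0}
    (h : Projectivization.mk ℂ u hu = Projectivization.mk ℂ v hv) : ∃ t : ℂ, t ≠ 0 ∧ v = t • u := by
  obtain ⟨t, ht⟩ := exists_smul_eq_of_cross_eq_zero hu
    ((Projectivization.mk_eq_mk_iff_crossProduct_eq_zero hu hv).mp h)
  exact ⟨t, fun h0 => hv (by rw [ht, h0, zero_smul]), ht⟩

namespace IsNondegenerate

variable {F : Fin 3 → MvPolynomial (Fin 3) ℂ} {d : ℕ}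

theorem evalVec_smul (hF : IsNondegenerate F d) (t : ℂ) (x : Fin 3 → ℂ) :
    evalVec F (t • x) = t ^ d • evalVec F x :=
  funext fun i => eval_smul_of_isHomogeneous (hF.isHomogeneous i) t x

theorem isHomogeneous_pullback (hF : IsNondegenerate F d) (c : Fin 3 → ℂ) :
    (pullback F c).IsHomogeneous d :=
  IsHomogeneous.sum _ _ _ fun i _ => (hF.isHomogeneous i).C_mul _

/-- Euler's identity. -/
theorem jacobian_mulVec_self (hF : IsNondegenerate F d) (x : Fin 3 → ℂ) :
    jacobian F x *ᵥ x = (d : ℂ) • evalVec F x := by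
  funext i
  have h := congrArg (eval x) (hF.isHomogeneous i).sum_X_mul_pderiv
  simp only [map_sum, map_mul, eval_X, map_nsmul] at h
  simp only [Matrix.mulVec, dotProduct, jacobian, Matrix.of_apply, Pi.smul_apply, smul_eq_mul,
    evalVec]
  rw [← nsmul_eq_mul, ← h]
  exact Finset.sum_congr rfl fun j _ => mul_comm _ _

/-- On every line there is a point whose image lies on a given line. -/
theorem exists_dotProduct_evalVec_eq_zero (hF : IsNondegenerate F d) {u : Fin 3 → ℂ} (hu : u ≠ 0)
    (e : Fin 3 → ℂ) : ∃ x, x ≠ 0 ∧ x ⬝ᵥ u = 0 ∧ evalVec F x ⬝ᵥ e = 0 := by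
  obtain ⟨x, hx, hxu⟩ := exists_dotProduct_eq_zero u
  by_cases h : evalVec F x ⬝ᵥ e = 0
  · exact ⟨x, hx, hxu, h⟩
  obtain ⟨y, hyu, hxy⟩ := exists_cross_ne_zero_of_dotProduct_eq_zero hu hx hxu
  rw [← eval_pullback] at h
  obtain ⟨z, hz, -⟩ := exists_root_on_line (hF.isHomogeneous_pullback e) hF.pos y h
  refine ⟨y + z • x, fun h0 => hxy ?_, ?_, by rw [← eval_pullback, hz]⟩
  · rw [eq_neg_of_add_eq_zero_left h0, map_neg, map_smul, cross_self, smul_zero, neg_zero]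
  · rw [add_dotProduct, smul_dotProduct, hyu, hxu, smul_zero, add_zero]

/-- The image of a line is not a point. -/
theorem exists_cross_evalVec_ne_zero (hF : IsNondegenerate F d) {u : Fin 3 → ℂ} (hu : u ≠ 0) :
    ∃ x y, x ⬝ᵥ u = 0 ∧ y ⬝ᵥ u = 0 ∧ evalVec F x ⨯₃ evalVec F y ≠ 0 := by
  obtain ⟨x, hx, hxu⟩ := exists_dotProduct_eq_zero u
  obtain ⟨e, he⟩ := exists_dotProduct_eq_one (hF.evalVec_ne_zero x hx)
  obtain ⟨y, hy, hyu, hye⟩ := hF.exists_dotProduct_evalVec_eq_zero hu e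
  refine ⟨x, y, hxu, hyu, fun h => ?_⟩
  obtain ⟨t, ht⟩ := exists_smul_eq_of_cross_eq_zero (hF.evalVec_ne_zero x hx) h
  rw [ht, smul_dotProduct, dotProduct_comm, he, smul_eq_mul, mul_one] at hye
  exact hF.evalVec_ne_zero y hy (by rw [ht, hye, zero_smul])

theorem cross_eq_zero_of_mapsLine (hF : IsNondegenerate F d) {u c c' : Fin 3 → ℂ} (hu : u ≠ 0)
    (h : MapsLine F u c) (h' : MapsLine F u c') : c ⨯₃ c' = 0 := by
  obtain ⟨x, y, hx, hy, hxy⟩ := hF.exists_cross_evalVec_ne_zero hu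
  have key : ∀ c, MapsLine F u c → (evalVec F x ⨯₃ evalVec F y) ⨯₃ c = 0 := fun c h => by
    rw [← cross_anticomm, cross_cross_eq_zero (h x hx) (h y hy), neg_zero]
  obtain ⟨s, rfl⟩ := exists_smul_eq_of_cross_eq_zero hxy (key c h)
  obtain ⟨t, rfl⟩ := exists_smul_eq_of_cross_eq_zero hxy (key c' h')
  simp

/-- A line that is mapped into a line is mapped onto it. -/
theorem exists_cross_evalVec_eq_zero (hF : IsNondegenerate F d) {u c : Fin 3 → ℂ} (hu : u ≠ 0)
    (hc : c ≠ 0) (h : MapsLine F u c) {y : Fin 3 → ℂ} (hyc : y ⬝ᵥ c = 0) :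
    ∃ x, x ≠ 0 ∧ x ⬝ᵥ u = 0 ∧ evalVec F x ⨯₃ y = 0 := by
  obtain ⟨w, hw⟩ := exists_dotProduct_eq_one hc
  obtain ⟨x, hx, hxu, hxe⟩ := hF.exists_dotProduct_evalVec_eq_zero hu (y ⨯₃ w)
  refine ⟨x, hx, hxu, ?_⟩
  obtain ⟨t, ht⟩ := exists_smul_eq_of_cross_eq_zero hc (cross_cross_eq_zero (h x hxu) hyc)
  rw [triple_product_permutation, triple_product_permutation, ht, dotProduct_smul, hw, smul_eq_mul,
    mul_one] at hxe
  rw [ht, hxe, zero_smul]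

theorem evalVec_surjective (hF : IsNondegenerate F d) : Function.Surjective (evalVec F) := by
  have h0 : evalVec F 0 = 0 := by
    simpa [hF.pos.ne'] using hF.evalVec_smul 0 0
  intro y
  by_cases hy : y = 0
  · exact ⟨0, by rw [hy, h0]⟩
  -- `a` and `b` span the orthogonal complement of `y`
  obtain ⟨a, ha, hay⟩ := exists_dotProduct_eq_zero y
  obtain ⟨b, hby, hab⟩ := exists_cross_ne_zero_of_dotProduct_eq_zero hy ha hay
  obtain ⟨x, hx, hxa, hxb⟩ := exists_common_zero (G₁ := pullback F a) (G₂ := pullback F b)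
    (by rw [eval_pullback, h0, zero_dotProduct]) (by rw [eval_pullback, h0, zero_dotProduct])
  rw [eval_pullback, dotProduct_comm] at hxa hxb
  obtain ⟨t, ht⟩ := exists_smul_eq_of_cross_eq_zero hy (cross_cross_eq_zero hay hby)
  obtain ⟨s, hs⟩ := exists_smul_eq_of_cross_eq_zero (hF.evalVec_ne_zero x hx)
    (cross_cross_eq_zero hxa hxb)
  have hs0 : s ≠ 0 := fun h => hab (by rw [hs, h, zero_smul])
  have ht0 : t ≠ 0 := fun h => hab (by rw [ht, h, zero_smul])
  -- `F x` is a nonzero multiple of `y`; rescaling `x` by a `d`-th root of the ratio gives `y`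
  obtain ⟨μ, hμ⟩ := IsAlgClosed.exists_pow_nat_eq (t⁻¹ * s) hF.pos
  refine ⟨μ • x, ?_⟩
  rw [hF.evalVec_smul, hμ, mul_smul, ← hs, ht, smul_smul, inv_mul_cancel₀ ht0, one_smul]

theorem pullback_ne_zero (hF : IsNondegenerate F d) {c : Fin 3 → ℂ} (hc : c ≠ 0) :
    pullback F c ≠ 0 := by
  intro h
  obtain ⟨w, hw⟩ := exists_dotProduct_eq_one hc
  obtain ⟨x, rfl⟩ := hF.evalVec_surjective w
  rw [← eval_pullback, h, map_zero] at hw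
  exact zero_ne_one hw

theorem jacobianDet_ne_zero (hF : IsNondegenerate F d) : jacobianDet F ≠ 0 :=
  jacobianDet_ne_zero_of_surjective hF.evalVec_surjective

/-- The fibres of a holomorphic self-map of the plane are finite. -/
theorem finite_fibre (hF : IsNondegenerate F d) {p : Fin 3 → ℂ} (hp : p ≠ 0) :
    {P : Projectivization ℂ (Fin 3 → ℂ) | p ⨯₃ evalVec F P.rep = 0}.Finite := by
  have h0 : evalVec F 0 = 0 := by
    simpa [hF.pos.ne'] using hF.evalVec_smul 0 0
  obtain ⟨a, ha, hap⟩ := exists_dotProduct_eq_zero p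
  obtain ⟨b, hbp, hab⟩ := exists_cross_ne_zero_of_dotProduct_eq_zero hp ha hap
  obtain ⟨w, hw⟩ := exists_dotProduct_eq_one hp
  refine (finite_of_common_zero_eq_zero (G₁ := pullback F a) (G₂ := pullback F b)
    (G₃ := pullback F w) (by rw [eval_pullback, h0, zero_dotProduct]) ?_).subset ?_
  · intro x hxa hxb hxw
    rw [eval_pullback, dotProduct_comm] at hxa hxb
    rw [eval_pullback] at hxw
    by_contra hx
    obtain ⟨t, ht⟩ := exists_smul_eq_of_cross_eq_zero hp (cross_cross_eq_zero hap hbp)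
    obtain ⟨s, hs⟩ := exists_smul_eq_of_cross_eq_zero (hF.evalVec_ne_zero x hx)
      (cross_cross_eq_zero hxa hxb)
    have h1 : w ⬝ᵥ (a ⨯₃ b) = 0 := by
      rw [hs, dotProduct_smul, dotProduct_comm, hxw, smul_zero]
    rw [ht, dotProduct_smul, hw, smul_eq_mul, mul_one] at h1
    exact hab (by rw [ht, h1, zero_smul])
  · intro P hP
    obtain ⟨t, ht⟩ := exists_smul_eq_of_cross_eq_zero hp hP
    constructor <;>
    · rw [mem_lineIdeal]
      intro s
      rw [eval_pullback, hF.evalVec_smul, ht, smul_dotProduct, smul_dotProduct, dotProduct_comm]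
      simp [hap, hbp]

end IsNondegenerate

/-! ### The form of a web in point-direction coordinates -/

theorem eval_aeval {σ τ : Type*} (g : σ → MvPolynomial τ ℂ) (z : τ → ℂ) (H : MvPolynomial σ ℂ) :
    eval z (aeval g H) = eval (fun i => eval z (g i)) H := by
  induction H using MvPolynomial.induction_on with
  | C c => simp
  | add p q hp hq => rw [map_add, map_add, map_add, hp, hq]
  | mul_X p i hp => rw [map_mul, map_mul, map_mul, hp, aeval_X, eval_X]

/-- The form `(x, v) ↦ H (x × v)`: for fixed `x` its zeros are the directions at `x` of the lines
of the web with equation `H`. -/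
def crossForm (H : MvPolynomial (Fin 3) ℂ) : MvPolynomial (Fin 3 ⊕ Fin 3) ℂ :=
  aeval ((fun i => X (Sum.inl i)) ⨯₃ (fun i => X (Sum.inr i)) :
    Fin 3 → MvPolynomial (Fin 3 ⊕ Fin 3) ℂ) H

theorem eval_cross {τ : Type*} (a b : Fin 3 → MvPolynomial τ ℂ) (z : τ → ℂ) :
    (fun i => eval z ((a ⨯₃ b) i)) = (fun i => eval z (a i)) ⨯₃ (fun i => eval z (b i)) := by
  funext i
  fin_cases i <;> simp [cross_apply]

theorem eval_crossForm (H : MvPolynomial (Fin 3) ℂ) (z : Fin 3 ⊕ Fin 3 → ℂ) :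
    eval z (crossForm H) = eval ((z ∘ Sum.inl) ⨯₃ (z ∘ Sum.inr)) H := by
  rw [crossForm, eval_aeval, eval_cross]
  simp only [eval_X]
  rfl

/-- A square dividing `H (x × v)` can only vanish where `x × v = 0`: along a section
`u ↦ (a × u, b × u)` of the cross product up to the linear form `ℓ = det (a, b, u)`, it becomes a
square dividing `ℓ ^ k * H u`. -/
theorem cross_eq_zero_of_mul_self_dvd_crossForm {H : MvPolynomial (Fin 3) ℂ} {k : ℕ}
    (hH : Irreducible H) (hk : H.IsHomogeneous k) {A : MvPolynomial (Fin 3 ⊕ Fin 3) ℂ}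
    (hA : A * A ∣ crossForm H) {z : Fin 3 ⊕ Fin 3 → ℂ} (hz : eval z A = 0) :
    (z ∘ Sum.inl) ⨯₃ (z ∘ Sum.inr) = 0 := by
  set x := z ∘ Sum.inl with hx
  set v := z ∘ Sum.inr with hv
  by_contra hu
  obtain ⟨w, hw⟩ := exists_dotProduct_eq_one hu
  set u := x ⨯₃ v with hudef
  have hxu : (w ⨯₃ x) ⨯₃ u = x := by
    rw [cross_cross_eq_smul_sub_smul, hw, hudef, dot_self_cross]; simp
  have hvu : (w ⨯₃ v) ⨯₃ u = v := by
    rw [cross_cross_eq_smul_sub_smul, hw, hudef, dot_cross_self]; simp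
  set a := w ⨯₃ x with ha
  set b := w ⨯₃ v with hb
  let g : Fin 3 ⊕ Fin 3 → MvPolynomial (Fin 3) ℂ :=
    Sum.elim ((fun i => C (a i)) ⨯₃ X) ((fun i => C (b i)) ⨯₃ X)
  have hg : ∀ y : Fin 3 → ℂ, (fun i => eval y (g i)) = Sum.elim (a ⨯₃ y) (b ⨯₃ y) := by
    intro y
    funext i
    cases i with
    | inl i => exact (congrFun (eval_cross (fun i => C (a i)) X y) i).trans (by simp)
    | inr i => exact (congrFun (eval_cross (fun i => C (b i)) X y) i).trans (by simp)
  set ℓ := linForm (a ⨯₃ b) with hℓ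
  have hsec : ∀ y : Fin 3 → ℂ, (a ⨯₃ y) ⨯₃ (b ⨯₃ y) = eval y ℓ • y := by
    intro y
    rw [cross_cross_eq_smul_sub_smul, dot_cross_self, zero_smul, sub_zero, hℓ, eval_linForm,
      triple_product_permutation, triple_product_permutation, dotProduct_comm]
  have hθ : aeval g (crossForm H) = ℓ ^ k * H := by
    refine MvPolynomial.funext fun y => ?_
    rw [eval_aeval, hg, eval_crossForm, Sum.elim_comp_inl, Sum.elim_comp_inr, hsec,
      eval_smul_of_isHomogeneous hk, map_mul, map_pow]
  have hℓu : eval u ℓ = 1 := by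
    have h := hsec u
    rw [hxu, hvu, ← hudef] at h
    have h2 := congrArg (w ⬝ᵥ ·) h
    simp only [dotProduct_smul, hw, smul_eq_mul, mul_one] at h2
    exact h2.symm
  have hBu : eval u (aeval g A) = 0 := by
    rw [eval_aeval, hg, hxu, hvu, hx, hv, Sum.elim_comp_inl_inr, hz]
  have hdvd : aeval g A * aeval g A ∣ ℓ ^ k * H := by
    rw [← hθ, ← map_mul]
    exact map_dvd _ hA
  have hnot : ¬ aeval g A ∣ ℓ ^ k := by
    rintro ⟨D, hD⟩
    have := congrArg (eval u) hD
    rw [map_pow, hℓu, one_pow, map_mul, hBu, zero_mul] at this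
    exact one_ne_zero this
  have hHu : eval u H = 0 := by
    obtain ⟨D, hD⟩ := hA
    have := congrArg (eval z) hD
    rwa [map_mul, map_mul, hz, zero_mul, zero_mul, eval_crossForm] at this
  by_cases hHA : H ∣ aeval g A
  -- if `H` divided `A (a × u, b × u)`, it would divide `ℓ ^ k`, but `H` vanishes at `u` and `ℓ`
  -- does not
  · have h1 : H * H ∣ ℓ ^ k * H := (mul_dvd_mul hHA hHA).trans hdvd
    obtain ⟨D, hD⟩ := (mul_dvd_mul_iff_right hH.ne_zero).mp h1
    have := congrArg (eval u) hD
    rw [map_pow, hℓu, one_pow, map_mul, hHu, zero_mul] at this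
    exact one_ne_zero this
  · have hrel : IsRelPrime (aeval g A) H := ((hH.isRelPrime_iff_not_dvd).mpr hHA).symm
    exact hnot (hrel.dvd_of_dvd_mul_right ((dvd_mul_right _ _).trans hdvd))

/-- The polynomial `H (x × v)` is squarefree: a square factor is nonzero off the common zeros of the
three coordinates of `x × v`, so it divides a power of each of them and involves no variable. -/
theorem squarefree_crossForm {H : MvPolynomial (Fin 3) ℂ} {k : ℕ}
    (hH : Irreducible H) (hk : H.IsHomogeneous k) : Squarefree (crossForm H) := by
  intro A hA
  have hminor : ∀ i, ∃ N, A ∣ (((fun i => X (Sum.inl i)) ⨯₃ (fun i => X (Sum.inr i)) :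
      Fin 3 → MvPolynomial (Fin 3 ⊕ Fin 3) ℂ) i) ^ N := fun i =>
    exists_dvd_pow_of_forall_eval_eq_zero fun z hz => by
      have h := cross_eq_zero_of_mul_self_dvd_crossForm hH hk hA hz
      have h2 := congrFun (eval_cross (fun i => X (Sum.inl i)) (fun i => X (Sum.inr i)) z) i
      simp only [eval_X] at h2
      exact h2.trans (congrFun h i)
  have hdeg : ∀ (j j₁ j₂ j₃ j₄ : Fin 3 ⊕ Fin 3), j ≠ j₁ → j ≠ j₂ → j ≠ j₃ → j ≠ j₄ →
      (∃ N, A ∣ (X j₁ * X j₂ - X j₃ * X j₄ : MvPolynomial (Fin 3 ⊕ Fin 3) ℂ) ^ N) →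
      (X j₁ * X j₂ - X j₃ * X j₄ : MvPolynomial (Fin 3 ⊕ Fin 3) ℂ) ≠ 0 → degreeOf j A = 0 := by
    rintro j j₁ j₂ j₃ j₄ h1 h2 h3 h4 ⟨N, D, hD⟩ hne
    have hX : ∀ i, j ≠ i → degreeOf j (X i : MvPolynomial (Fin 3 ⊕ Fin 3) ℂ) = 0 := fun i hi => by
      rw [degreeOf_X, if_neg hi]
    have hm : degreeOf j (X j₁ * X j₂ - X j₃ * X j₄ : MvPolynomial (Fin 3 ⊕ Fin 3) ℂ) = 0 := by
      have a1 := degreeOf_mul_le j (X j₁ : MvPolynomial (Fin 3 ⊕ Fin 3) ℂ) (X j₂)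
      have a2 := degreeOf_mul_le j (X j₃ : MvPolynomial (Fin 3 ⊕ Fin 3) ℂ) (X j₄)
      have a3 := degreeOf_sub_le j (X j₁ * X j₂ : MvPolynomial (Fin 3 ⊕ Fin 3) ℂ) (X j₃ * X j₄)
      rw [hX _ h1, hX _ h2] at a1
      rw [hX _ h3, hX _ h4] at a2
      omega
    have hpow := degreeOf_pow_le j (X j₁ * X j₂ - X j₃ * X j₄ : MvPolynomial (Fin 3 ⊕ Fin 3) ℂ) N
    have hAD : A * D ≠ 0 := hD ▸ pow_ne_zero N hne
    rw [hm, mul_zero, hD, degreeOf_mul_eq (left_ne_zero_of_mul hAD) (right_ne_zero_of_mul hAD)]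
      at hpow
    omega
  have hne : ∀ (j₁ j₂ j₃ j₄ : Fin 3 ⊕ Fin 3), j₃ ≠ j₁ → j₃ ≠ j₂ →
      (X j₁ * X j₂ - X j₃ * X j₄ : MvPolynomial (Fin 3 ⊕ Fin 3) ℂ) ≠ 0 := by
    intro j₁ j₂ j₃ j₄ h1 h2 h
    have := congrArg (eval (fun j => if j = j₃ then (0 : ℂ) else 1)) h
    simp [h1.symm, h2.symm] at this
  have hdeg0 : ∀ j, degreeOf j A = 0 := by
    have m0 := hminor 0
    have m1 := hminor 1
    have m2 := hminor 2
    simp only [cross_apply, Matrix.cons_val] at m0 m1 m2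
    intro j
    rcases j with i | i <;> fin_cases i
    · exact hdeg _ _ _ _ _ (by simp) (by simp) (by simp) (by simp) m0
        (hne _ _ _ _ (by simp) (by simp))
    · exact hdeg _ _ _ _ _ (by simp) (by simp) (by simp) (by simp) m1
        (hne _ _ _ _ (by simp) (by simp))
    · exact hdeg _ _ _ _ _ (by simp) (by simp) (by simp) (by simp) m2
        (hne _ _ _ _ (by simp) (by simp))
    · exact hdeg _ _ _ _ _ (by simp) (by simp) (by simp) (by simp) m0
        (hne _ _ _ _ (by simp) (by simp))
    · exact hdeg _ _ _ _ _ (by simp) (by simp) (by simp) (by simp) m1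
        (hne _ _ _ _ (by simp) (by simp))
    · exact hdeg _ _ _ _ _ (by simp) (by simp) (by simp) (by simp) m2
        (hne _ _ _ _ (by simp) (by simp))
  have hA0 : A ≠ 0 := by
    rintro rfl
    obtain ⟨N, hN⟩ := hminor 0
    simp only [cross_apply, Matrix.cons_val] at hN
    exact pow_ne_zero N (hne _ _ _ _ (by simp) (by simp)) (zero_dvd_iff.mp hN)
  have htot : A.totalDegree = 0 := by
    rw [totalDegree_eq_zero_iff]
    intro m hm j
    have := (degreeOf_le_iff (n := j) (f := A) (d := 0)).mp (hdeg0 j).le m hm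
    omega
  obtain hC := totalDegree_eq_zero_iff_eq_C.mp htot
  rw [hC]
  refine (isUnit_iff_ne_zero.mpr fun h0 => hA0 ?_).map C
  rw [hC, h0, map_zero]

/-- The form `(x, v) ↦ H (F x × DF x v)`, the pullback under `F` of `crossForm H`. -/
def tangentForm (F : Fin 3 → MvPolynomial (Fin 3) ℂ) (H : MvPolynomial (Fin 3) ℂ) :
    MvPolynomial (Fin 3 ⊕ Fin 3) ℂ :=
  aeval ((fun i => rename Sum.inl (F i)) ⨯₃
    (fun i => ∑ j, rename Sum.inl (pderiv j (F i)) * X (Sum.inr j)) :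
      Fin 3 → MvPolynomial (Fin 3 ⊕ Fin 3) ℂ) H

theorem eval_tangentForm (F : Fin 3 → MvPolynomial (Fin 3) ℂ) (H : MvPolynomial (Fin 3) ℂ)
    (z : Fin 3 ⊕ Fin 3 → ℂ) :
    eval z (tangentForm F H) = eval (evalVec F (z ∘ Sum.inl) ⨯₃
      (jacobian F (z ∘ Sum.inl) *ᵥ (z ∘ Sum.inr))) H := by
  rw [tangentForm, eval_aeval, eval_cross]
  simp only [map_sum, map_mul, eval_X, eval_rename]
  rfl

/-- The web with equation `H` is invariant under `F`, in coordinates: each of its lines is mapped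
into one of its lines. -/
def Invariant (F : Fin 3 → MvPolynomial (Fin 3) ℂ) (H : MvPolynomial (Fin 3) ℂ) : Prop :=
  ∀ u, u ≠ 0 → eval u H = 0 → ∃ c, c ≠ 0 ∧ eval c H = 0 ∧ MapsLine F u c

variable {F : Fin 3 → MvPolynomial (Fin 3) ℂ} {H : MvPolynomial (Fin 3) ℂ} {d k : ℕ}

theorem crossForm_dvd_tangentForm (hF : IsNondegenerate F d) (hH : Irreducible H)
    (hk : H.IsHomogeneous k) (hk0 : 0 < k) (hinv : Invariant F H) :
    crossForm H ∣ tangentForm F H := by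
  have h0 : eval 0 H = 0 := by
    simpa [hk0.ne'] using eval_smul_of_isHomogeneous hk 0 0
  obtain ⟨N, hN⟩ := exists_dvd_pow_of_forall_eval_eq_zero (A := crossForm H)
    (B := tangentForm F H) fun z hz => by
      rw [eval_crossForm] at hz
      rw [eval_tangentForm]
      set x := z ∘ Sum.inl
      set v := z ∘ Sum.inr
      by_cases hu : x ⨯₃ v = 0
      · suffices h : evalVec F x ⨯₃ (jacobian F x *ᵥ v) = 0 by rw [h, h0]
        by_cases hx : x = 0
        · have : evalVec F x = 0 := by
            rw [hx]; simpa [hF.pos.ne'] using hF.evalVec_smul 0 0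
          rw [this]; simp
        · obtain ⟨t, ht⟩ := exists_smul_eq_of_cross_eq_zero hx hu
          rw [ht, Matrix.mulVec_smul, hF.jacobian_mulVec_self]
          simp
      · obtain ⟨c, hc, hcH, hmap⟩ := hinv _ hu hz
        obtain ⟨t, ht⟩ := exists_smul_eq_of_cross_eq_zero hc (cross_cross_eq_zero
          (hmap x (dot_self_cross x v))
          (hmap.jacobian_mulVec (dot_self_cross x v) (dot_cross_self x v)))
        rw [ht, eval_smul_of_isHomogeneous hk, hcH, mul_zero]
  exact (squarefree_crossForm hH hk).isRadical N _ hN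

theorem isHomogeneous_linForm (v : Fin 3 → ℂ) : (linForm v).IsHomogeneous 1 :=
  IsHomogeneous.sum _ _ _ fun i _ => isHomogeneous_C_mul_X _ i

/-- The polynomial `x ↦ G (x × y)`. -/
def precompCross (y : Fin 3 → ℂ) (G : MvPolynomial (Fin 3) ℂ) : MvPolynomial (Fin 3) ℂ :=
  aeval (fun i => linForm (y ⨯₃ Pi.single i 1)) G

theorem eval_precompCross (y : Fin 3 → ℂ) (G : MvPolynomial (Fin 3) ℂ) (x : Fin 3 → ℂ) :
    eval x (precompCross y G) = eval (x ⨯₃ y) G := by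
  rw [precompCross, eval_aeval]
  congr 2
  funext i
  rw [eval_linForm, ← triple_product_permutation, single_dotProduct, one_mul]

theorem isHomogeneous_precompCross {G : MvPolynomial (Fin 3) ℂ} {n : ℕ} (hG : G.IsHomogeneous n)
    (y : Fin 3 → ℂ) : (precompCross y G).IsHomogeneous n := by
  have h := hG.aeval _ fun i => isHomogeneous_linForm (y ⨯₃ Pi.single i 1)
  rwa [one_mul] at h

/-- At a point where neither form vanishes identically in the direction, the pulled back web has no
directions other than those of the web: both forms have the same degree in the direction, so their
quotient is a constant there. -/
theorem eval_cross_eq_zero_of_tangent (hF : IsNondegenerate F d) (hH : Irreducible H)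
    (hk : H.IsHomogeneous k) (hk0 : 0 < k) (hinv : Invariant F H) {q v v₁ v₂ : Fin 3 → ℂ}
    (h₁ : eval (q ⨯₃ v₁) H ≠ 0) (h₂ : eval (evalVec F q ⨯₃ (jacobian F q *ᵥ v₂)) H ≠ 0)
    (h : eval (evalVec F q ⨯₃ (jacobian F q *ᵥ v)) H = 0) : eval (q ⨯₃ v) H = 0 := by
  obtain ⟨M, hM⟩ := crossForm_dvd_tangentForm hF hH hk hk0 hinv
  let A : MvPolynomial (Fin 3) ℂ := aeval (fun i => linForm (Pi.single i 1 ⨯₃ q)) H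
  let B : MvPolynomial (Fin 3) ℂ :=
    aeval (fun i => linForm ((jacobian F q)ᵀ *ᵥ (Pi.single i 1 ⨯₃ evalVec F q))) H
  let D : MvPolynomial (Fin 3) ℂ := aeval (Sum.elim (fun i => C (q i)) X) M
  have hA : ∀ y, eval y A = eval (q ⨯₃ y) H := fun y => by
    rw [eval_aeval]
    congr 2
    funext i
    rw [eval_linForm, triple_product_permutation, single_dotProduct, one_mul]
  have hB : ∀ y, eval y B = eval (evalVec F q ⨯₃ (jacobian F q *ᵥ y)) H := fun y => by
    rw [eval_aeval]
    congr 2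
    funext i
    rw [eval_linForm, Matrix.mulVec_transpose, dotProduct_comm, ← Matrix.dotProduct_mulVec,
      dotProduct_comm, triple_product_permutation, single_dotProduct, one_mul]
  have hBAD : B = A * D := by
    refine MvPolynomial.funext fun y => ?_
    have h1 := congrArg (eval (Sum.elim q y)) hM
    rw [map_mul, eval_tangentForm, eval_crossForm, Sum.elim_comp_inl, Sum.elim_comp_inr] at h1
    rw [map_mul, hA, hB, h1, eval_aeval]
    congr 3
    funext i
    cases i <;> simp
  have hA0 : A ≠ 0 := fun h0 => h₁ (by rw [← hA, h0, map_zero])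
  have hB0 : B ≠ 0 := fun h0 => h₂ (by rw [← hB, h0, map_zero])
  have hD0 : D ≠ 0 := by rintro h0; exact hB0 (by rw [hBAD, h0, mul_zero])
  have hAk : A.IsHomogeneous (1 * k) := hk.aeval _ fun i => isHomogeneous_linForm _
  have hBk : B.IsHomogeneous (1 * k) := hk.aeval _ fun i => isHomogeneous_linForm _
  have hdeg := congrArg totalDegree hBAD
  rw [totalDegree_mul_of_isDomain hA0 hD0, hAk.totalDegree hA0, hBk.totalDegree hB0] at hdeg
  have hC := totalDegree_eq_zero_iff_eq_C.mp (by omega : D.totalDegree = 0)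
  rw [← hB, hBAD, map_mul, mul_eq_zero, hA] at h
  refine h.resolve_right fun h0 => hD0 ?_
  rw [hC, eval_C] at h0
  rw [hC, h0, map_zero]

/-! ### Invariance implies total invariance -/

/-- The web with equation `H` is totally invariant under `F`, in coordinates: every point that is
mapped into a line of the web lies on a line of the web that is mapped into it. -/
def TotallyInvariant (F : Fin 3 → MvPolynomial (Fin 3) ℂ) (H : MvPolynomial (Fin 3) ℂ) : Prop :=
  ∀ c, c ≠ 0 → eval c H = 0 → ∀ q, q ≠ 0 → evalVec F q ⬝ᵥ c = 0 →
    ∃ u, u ≠ 0 ∧ eval u H = 0 ∧ q ⬝ᵥ u = 0 ∧ MapsLine F u c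

/-- The pairs `(q, c)` such that some line of the web through `q` is mapped into the line `c`. -/
def liftable (F : Fin 3 → MvPolynomial (Fin 3) ℂ) (H : MvPolynomial (Fin 3) ℂ) :
    Set ((Fin 3 → ℂ) × (Fin 3 → ℂ)) :=
  {p | ∃ u, u ≠ 0 ∧ eval u H = 0 ∧ p.1 ⬝ᵥ u = 0 ∧ MapsLine F u p.2}

theorem continuous_crossProduct {α : Type*} [TopologicalSpace α] {f g : α → Fin 3 → ℂ}
    (hf : Continuous f) (hg : Continuous g) : Continuous fun t => f t ⨯₃ g t := by
  simp only [cross_apply]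
  refine continuous_pi fun i => ?_
  fin_cases i <;> simp <;> fun_prop

theorem continuous_evalVec (F : Fin 3 → MvPolynomial (Fin 3) ℂ) : Continuous (evalVec F) :=
  continuous_pi fun i => MvPolynomial.continuous_eval (F i)

theorem mapsLine_iff_forall_cross {F : Fin 3 → MvPolynomial (Fin 3) ℂ} {u c : Fin 3 → ℂ}
    (hu : u ≠ 0) : MapsLine F u c ↔ ∀ y, evalVec F (u ⨯₃ y) ⬝ᵥ c = 0 := by
  refine ⟨fun h y => h _ (by rw [dotProduct_comm]; exact dot_self_cross u y), fun h x hx => ?_⟩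
  obtain ⟨y, rfl⟩ := exists_cross_eq_of_dotProduct_eq_zero hu hx
  exact h y

/-- Being liftable is a closed condition, since the lines through a point form a compact family. -/
theorem isClosed_liftable (F : Fin 3 → MvPolynomial (Fin 3) ℂ) {H : MvPolynomial (Fin 3) ℂ} {k : ℕ}
    (hk : H.IsHomogeneous k) : IsClosed (liftable F H) := by
  let T : Set (Metric.sphere (0 : Fin 3 → ℂ) 1 × ((Fin 3 → ℂ) × (Fin 3 → ℂ))) :=
    {p | eval (p.1 : Fin 3 → ℂ) H = 0 ∧ p.2.1 ⬝ᵥ (p.1 : Fin 3 → ℂ) = 0 ∧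
      ∀ y, evalVec F ((p.1 : Fin 3 → ℂ) ⨯₃ y) ⬝ᵥ p.2.2 = 0}
  have hfst : Continuous fun p : Metric.sphere (0 : Fin 3 → ℂ) 1 × ((Fin 3 → ℂ) × (Fin 3 → ℂ)) =>
    (p.1 : Fin 3 → ℂ) := continuous_subtype_val.comp continuous_fst
  have hT : IsClosed T := by
    refine IsClosed.inter ?_ (IsClosed.inter ?_ ?_)
    · exact isClosed_eq ((MvPolynomial.continuous_eval H).comp hfst) continuous_const
    · exact isClosed_eq ((continuous_fst.comp continuous_snd).dotProduct hfst) continuous_const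
    · have : ∀ y, IsClosed {p : Metric.sphere (0 : Fin 3 → ℂ) 1 × ((Fin 3 → ℂ) × (Fin 3 → ℂ)) |
          evalVec F ((p.1 : Fin 3 → ℂ) ⨯₃ y) ⬝ᵥ p.2.2 = 0} := fun y =>
        isClosed_eq (((continuous_evalVec F).comp
          (continuous_crossProduct hfst continuous_const)).dotProduct
            (continuous_snd.comp continuous_snd)) continuous_const
      have h := isClosed_iInter this
      rwa [← Set.ofPred_forall] at h
  have himage : liftable F H = Prod.snd '' T := by
    ext ⟨q, c⟩
    constructor
    · rintro ⟨u, hu, hH, hq, hmap⟩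
      have hn : ((‖u‖⁻¹ : ℝ) : ℂ) ≠ 0 := by simpa using hu
      have hu1 : ((‖u‖⁻¹ : ℝ) : ℂ) • u ∈ Metric.sphere (0 : Fin 3 → ℂ) 1 := by
        simp [norm_smul, inv_mul_cancel₀ (norm_ne_zero_iff.mpr hu)]
      refine ⟨(⟨_, hu1⟩, (q, c)), ⟨?_, ?_, ?_⟩, rfl⟩
      · rw [eval_smul_of_isHomogeneous hk, hH, mul_zero]
      · change q ⬝ᵥ (((‖u‖⁻¹ : ℝ) : ℂ) • u) = 0
        rw [dotProduct_smul, hq, smul_zero]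
      · exact (mapsLine_iff_forall_cross (smul_ne_zero hn hu)).mp (hmap.smul_left hn)
    · rintro ⟨⟨u, q', c'⟩, ⟨h1, h2, h3⟩, h⟩
      obtain ⟨rfl, rfl⟩ := Prod.mk.inj h
      have hu : (u : Fin 3 → ℂ) ≠ 0 := ne_zero_of_mem_unit_sphere u
      exact ⟨u, hu, h1, h2, (mapsLine_iff_forall_cross hu).mpr h3⟩
  rw [himage]
  exact isClosedMap_snd_of_compactSpace _ hT

/-- Continuity of roots: a zero of a form on a line moves continuously with the line. -/
theorem exists_tendsto_root {φ : MvPolynomial (Fin 3) ℂ} {n : ℕ} (h : φ.IsHomogeneous n)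
    (hn : 0 < n) {α : Type*} {l : Filter α} {x a : α → Fin 3 → ℂ} {x₀ a₀ : Fin 3 → ℂ}
    (hx : Tendsto x l (𝓝 x₀)) (ha : Tendsto a l (𝓝 a₀)) (hx₀ : eval x₀ φ = 0)
    (ha₀ : eval a₀ φ ≠ 0) :
    ∃ z : α → ℂ, Tendsto z l (𝓝 0) ∧ ∀ t, eval (a t) φ ≠ 0 → eval (x t + z t • a t) φ = 0 := by
  have hex : ∀ t, ∃ z : ℂ, eval (a t) φ ≠ 0 →
      eval (x t + z • a t) φ = 0 ∧ ‖z‖ ^ n * ‖eval (a t) φ‖ ≤ ‖eval (x t) φ‖ := by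
    intro t
    by_cases hat : eval (a t) φ = 0
    · exact ⟨0, fun h => absurd hat h⟩
    · obtain ⟨z, hz⟩ := exists_root_on_line h hn (x t) hat
      exact ⟨z, fun _ => hz⟩
  choose z hz using hex
  refine ⟨z, ?_, fun t ht => (hz t ht).1⟩
  have hxφ := ((MvPolynomial.continuous_eval φ).tendsto x₀).comp hx
  have haφ := ((MvPolynomial.continuous_eval φ).tendsto a₀).comp ha
  have hquot : Tendsto (fun t => ‖eval (x t) φ‖ / ‖eval (a t) φ‖) l (𝓝 0) := by
    have := hxφ.norm.div haφ.norm (norm_ne_zero_iff.mpr ha₀)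
    rwa [hx₀, norm_zero, zero_div] at this
  rw [tendsto_zero_iff_norm_tendsto_zero, Metric.tendsto_nhds]
  intro ε hε
  filter_upwards [hquot.eventually (gt_mem_nhds (pow_pos hε n)), haφ.eventually_ne ha₀]
    with t ht hat
  rw [Real.dist_0_eq_abs, abs_norm]
  have hpos : 0 < ‖eval (a t) φ‖ := norm_pos_iff.mpr hat
  exact lt_of_pow_lt_pow_left₀ n hε.le (lt_of_le_of_lt
    ((le_div_iff₀ hpos).mpr (hz t hat).2) ht)

theorem eventually_notMem_of_finite {S : Set ℂ} (hS : S.Finite) :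
    ∀ᶠ t in 𝓝[≠] (0 : ℂ), t ∉ S := by
  have h : (S \ {0})ᶜ ∈ 𝓝 (0 : ℂ) :=
    (hS.subset Set.sdiff_subset).isClosed.isOpen_compl.mem_nhds (by simp)
  filter_upwards [mem_nhdsWithin_of_mem_nhds h, self_mem_nhdsWithin] with t h1 h2 h3
  exact h1 ⟨h3, h2⟩

theorem eventually_eval_ne_zero {p : Polynomial ℂ} (hp : p ≠ 0) :
    ∀ᶠ t in 𝓝[≠] (0 : ℂ), p.eval t ≠ 0 := by
  have hfin : {t | p.eval t = 0}.Finite := by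
    refine p.roots.toFinset.finite_toSet.subset fun t ht => ?_
    simpa [hp] using ht
  exact eventually_notMem_of_finite hfin

/-- Away from the critical curve, tangent directions lift, and so do lines of an invariant web. -/
theorem mem_liftable_of_det_ne_zero (hF : IsNondegenerate F d) (hH : Irreducible H)
    (hk : H.IsHomogeneous k) (hk0 : 0 < k) (hinv : Invariant F H) {q v₁ w w₁ : Fin 3 → ℂ}
    (hdet : (jacobian F q).det ≠ 0) (h₁ : eval (q ⨯₃ v₁) H ≠ 0)
    (h₂ : eval (evalVec F q ⨯₃ w₁) H ≠ 0) (hw : evalVec F q ⨯₃ w ≠ 0)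
    (hwH : eval (evalVec F q ⨯₃ w) H = 0) : (q, evalVec F q ⨯₃ w) ∈ liftable F H := by
  have hsurj : ∀ w, ∃ v, jacobian F q *ᵥ v = w := fun w => by
    refine ⟨(jacobian F q)⁻¹ *ᵥ w, ?_⟩
    rw [Matrix.mulVec_mulVec, Matrix.mul_nonsing_inv _ (isUnit_iff_ne_zero.mpr hdet),
      Matrix.one_mulVec]
  obtain ⟨v, rfl⟩ := hsurj w
  obtain ⟨v₂, rfl⟩ := hsurj w₁
  have hu : q ⨯₃ v ≠ 0 := fun h0 => by
    by_cases hq : q = 0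
    · refine h₁ ?_
      rw [hq, map_zero, LinearMap.zero_apply]
      simpa [hk0.ne'] using eval_smul_of_isHomogeneous hk 0 0
    · obtain ⟨t, rfl⟩ := exists_smul_eq_of_cross_eq_zero hq h0
      refine hw ?_
      rw [Matrix.mulVec_smul, hF.jacobian_mulVec_self]
      simp
  have huH := eval_cross_eq_zero_of_tangent hF hH hk hk0 hinv h₁ h₂ hwH
  obtain ⟨c, hc, -, hmap⟩ := hinv _ hu huH
  obtain ⟨t, ht⟩ := exists_smul_eq_of_cross_eq_zero hc (cross_cross_eq_zero
    (hmap q (dot_self_cross q v))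
    (hmap.jacobian_mulVec (dot_self_cross q v) (dot_cross_self q v)))
  refine ⟨_, hu, huH, dot_self_cross q v, ?_⟩
  rw [ht]
  exact hmap.smul_right t

theorem exists_precompCross_ne_zero (hH : H ≠ 0) (hk : H.IsHomogeneous k) (hk0 : 0 < k) :
    ∃ y, precompCross y H ≠ 0 := by
  obtain ⟨u, hu⟩ : ∃ u, eval u H ≠ 0 := by
    by_contra! h
    exact hH (MvPolynomial.funext fun x => by rw [h, map_zero])
  have hu0 : u ≠ 0 := by
    rintro rfl
    exact hu (by simpa [hk0.ne'] using eval_smul_of_isHomogeneous hk 0 0)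
  obtain ⟨x, hx, hxu⟩ := exists_dotProduct_eq_zero u
  obtain ⟨y, hy⟩ := exists_cross_eq_of_dotProduct_eq_zero (x := u) hx
    (by rw [dotProduct_comm]; exact hxu)
  refine ⟨y, fun h0 => hu ?_⟩
  rw [← hy, ← eval_precompCross, h0, map_zero]

/-- A point whose image is not the base point of the web (if the web is a pencil) is a limit of
points off the critical curve, and the lines of the web through its image follow. -/
theorem mem_liftable_of_eval_cross_ne_zero (hF : IsNondegenerate F d) (hH : Irreducible H)
    (hk : H.IsHomogeneous k) (hk0 : 0 < k) (hinv : Invariant F H) {q c y₁ : Fin 3 → ℂ}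
    (hq : q ≠ 0) (hc : c ≠ 0) (hcH : eval c H = 0) (hqc : evalVec F q ⬝ᵥ c = 0)
    (hy₁ : eval (evalVec F q ⨯₃ y₁) H ≠ 0) : (q, c) ∈ liftable F H := by
  obtain ⟨y₀, hy₀⟩ := exists_cross_eq_of_dotProduct_eq_zero (hF.evalVec_ne_zero q hq)
    (by rwa [dotProduct_comm] : c ⬝ᵥ evalVec F q = 0)
  obtain ⟨a, ha⟩ := exists_precompCross_ne_zero hH.ne_zero hk hk0
  set Q := jacobianDet F * precompCross a H with hQ
  obtain ⟨w, hw⟩ : ∃ w, eval w Q ≠ 0 := by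
    by_contra! h
    exact mul_ne_zero hF.jacobianDet_ne_zero ha
      (MvPolynomial.funext fun x => by rw [h, map_zero])
  -- move `q` to `q_t = q + t (w - q)`, and `c = F q × y₀` to a nearby line `F q_t × (y₀ + z y₁)` of
  -- the web
  have hline : lineRestrict Q q (w - q) ≠ 0 := fun h0 => hw (by
    have := eval_lineRestrict Q q (w - q) 1
    rw [h0, one_smul, add_sub_cancel, Polynomial.eval_zero] at this
    exact this.symm)
  have hqt : Tendsto (fun t : ℂ => q + t • (w - q)) (𝓝[≠] 0) (𝓝 q) := by
    have : Continuous fun t : ℂ => q + t • (w - q) := by fun_prop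
    simpa using (this.tendsto 0).mono_left nhdsWithin_le_nhds
  have hcross : ∀ y, Tendsto (fun t : ℂ => evalVec F (q + t • (w - q)) ⨯₃ y) (𝓝[≠] 0)
      (𝓝 (evalVec F q ⨯₃ y)) := fun y =>
    ((continuous_crossProduct (continuous_evalVec F) continuous_const).tendsto q).comp hqt
  obtain ⟨z, hz, hroot⟩ := exists_tendsto_root hk hk0 (hcross y₀) (hcross y₁)
    (by rw [hy₀, hcH]) hy₁
  have hct : Tendsto (fun t : ℂ => evalVec F (q + t • (w - q)) ⨯₃ (y₀ + z t • y₁)) (𝓝[≠] 0)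
      (𝓝 c) := by
    have := (hcross y₀).add (hz.smul (hcross y₁))
    simpa only [map_add, map_smul, zero_smul, add_zero, hy₀] using this
  refine (isClosed_liftable F hk).mem_of_tendsto (hqt.prodMk_nhds hct) ?_
  filter_upwards [eventually_eval_ne_zero hline, hct.eventually_ne hc,
    (((MvPolynomial.continuous_eval H).tendsto _).comp (hcross y₁)).eventually_ne hy₁]
    with t ht1 ht2 ht3
  rw [eval_lineRestrict, hQ, map_mul, mul_ne_zero_iff, eval_jacobianDet, eval_precompCross] at ht1
  refine mem_liftable_of_det_ne_zero hF hH hk hk0 hinv ht1.1 ht1.2 ht3 ht2 ?_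
  rw [map_add, map_smul]
  exact hroot t ht3

/-- Points `q + t b + z a`, with `q`, `b`, `a` independent, are distinct for distinct `t`. -/
theorem exists_injective_mk {q b a : Fin 3 → ℂ} (h : b ⬝ᵥ (a ⨯₃ q) = 1) (z : ℂ → ℂ) :
    ∃ hne : ∀ t : ℂ, q + t • b + z t • a ≠ 0,
      Function.Injective fun t => Projectivization.mk ℂ (q + t • b + z t • a) (hne t) := by
  have h1 : ∀ t, (q + t • b + z t • a) ⬝ᵥ (b ⨯₃ a) = 1 := fun t => by
    rw [add_dotProduct, add_dotProduct, smul_dotProduct, smul_dotProduct, dot_self_cross,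
      dot_cross_self, triple_product_permutation, h]
    simp
  have h2 : ∀ t, (q + t • b + z t • a) ⬝ᵥ (a ⨯₃ q) = t := fun t => by
    rw [add_dotProduct, add_dotProduct, smul_dotProduct, smul_dotProduct, dot_self_cross,
      dot_cross_self, h]
    simp
  refine ⟨fun t h0 => one_ne_zero (by rw [← h1 t, h0, zero_dotProduct]), fun s t hst => ?_⟩
  obtain ⟨r, -, hr⟩ := exists_smul_of_mk_eq hst
  have k1 := congrArg (· ⬝ᵥ (b ⨯₃ a)) hr
  have k2 := congrArg (· ⬝ᵥ (a ⨯₃ q)) hr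
  simp only [smul_dotProduct, h1, h2, smul_eq_mul, mul_one] at k1 k2
  rw [k2, ← k1, one_mul]

/-- If `H` vanishes on the plane orthogonal to `p`, the web is the pencil of lines through `p`. -/
theorem eval_eq_zero_iff_of_forall_cross (hH : Irreducible H) {p : Fin 3 → ℂ} (hp : p ≠ 0)
    (h : ∀ y, eval (p ⨯₃ y) H = 0) (u : Fin 3 → ℂ) : eval u H = 0 ↔ u ⬝ᵥ p = 0 := by
  have h1 : ∀ u : Fin 3 → ℂ, u ⬝ᵥ p = 0 → eval u H = 0 := fun u hu => by
    obtain ⟨y, rfl⟩ := exists_cross_eq_of_dotProduct_eq_zero hp hu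
    exact h y
  refine ⟨fun hu => ?_, h1 u⟩
  obtain ⟨N, hN⟩ := exists_dvd_pow_of_forall_eval_eq_zero (A := linForm p) (B := H) fun x hx =>
    h1 x (by rwa [eval_linForm] at hx)
  obtain ⟨i, -, hi⟩ := (dvd_prime_pow hH.prime N).mp hN
  obtain ⟨W, hW⟩ := hi
  have hWu : ∀ x, eval x (W : MvPolynomial (Fin 3) ℂ) ≠ 0 := fun x =>
    (W.isUnit.map (eval x)).ne_zero
  have hi0 : i ≠ 0 := by
    rintro rfl
    have := congrArg (eval 0) hW
    rw [map_mul, eval_linForm, zero_dotProduct, zero_mul, pow_zero, map_one] at this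
    exact zero_ne_one this
  have := congrArg (eval u) hW
  rw [map_mul, map_pow, hu, zero_pow hi0, eval_linForm] at this
  exact (mul_eq_zero.mp this).resolve_right (hWu u)

/-- If the web is the pencil of lines through the image of `q`, any line through that image is
followed along its preimage near `q`, off the finitely many points with the same image. -/
theorem mem_liftable_of_forall_cross (hF : IsNondegenerate F d) (hH : Irreducible H)
    (hk : H.IsHomogeneous k) (hinv : Invariant F H) {q c : Fin 3 → ℂ}
    (hq : q ≠ 0) (hc : c ≠ 0) (hqc : evalVec F q ⬝ᵥ c = 0)
    (hpencil : ∀ y, eval (evalVec F q ⨯₃ y) H = 0) : (q, c) ∈ liftable F H := by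
  set p := evalVec F q with hp
  have hp0 : p ≠ 0 := hF.evalVec_ne_zero q hq
  have hHp := eval_eq_zero_iff_of_forall_cross hH hp0 hpencil
  obtain ⟨a, ha⟩ : ∃ a, eval a (pullback F c) ≠ 0 := by
    by_contra! h
    exact hF.pullback_ne_zero hc (MvPolynomial.funext fun x => by rw [h, map_zero])
  have haq : a ⨯₃ q ≠ 0 := fun h0 => by
    obtain ⟨t, ht⟩ := exists_smul_eq_of_cross_eq_zero hq
      (by rw [← cross_anticomm, h0, neg_zero] : q ⨯₃ a = 0)
    rw [ht, eval_pullback, hF.evalVec_smul, smul_dotProduct, ← hp, hqc, smul_zero] at ha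
    exact ha rfl
  obtain ⟨b, hb⟩ := exists_dotProduct_eq_one haq
  have hbt : Tendsto (fun t : ℂ => q + t • b) (𝓝[≠] 0) (𝓝 q) := by
    have : Continuous fun t : ℂ => q + t • b := by fun_prop
    simpa using (this.tendsto 0).mono_left nhdsWithin_le_nhds
  obtain ⟨z, hz, hroot⟩ := exists_tendsto_root (hF.isHomogeneous_pullback c) hF.pos hbt
    (tendsto_const_nhds (x := a)) (by rw [eval_pullback, ← hp, hqc]) ha
  obtain ⟨hne, hinj⟩ := exists_injective_mk hb z
  have hXt : Tendsto (fun t : ℂ => q + t • b + z t • a) (𝓝[≠] 0) (𝓝 q) := by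
    have := hbt.add (hz.smul (tendsto_const_nhds (x := a)))
    simpa only [zero_smul, add_zero] using this
  -- only finitely many of the points on the preimage of `c` near `q` are mapped to `p`
  have hfin : {t : ℂ | p ⨯₃ evalVec F (q + t • b + z t • a) = 0}.Finite := by
    refine ((hF.finite_fibre hp0).preimage hinj.injOn).subset fun t ht => ?_
    obtain ⟨s, -, hs⟩ := exists_smul_of_mk_eq (Projectivization.mk_rep
      (Projectivization.mk ℂ (q + t • b + z t • a) (hne t))).symm
    change p ⨯₃ evalVec F (Projectivization.rep _) = 0
    rw [hs, hF.evalVec_smul, map_smul, ht, smul_zero]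
  refine (isClosed_liftable F hk).mem_of_tendsto
    (hXt.prodMk_nhds (tendsto_const_nhds (x := c))) ?_
  filter_upwards [eventually_notMem_of_finite hfin] with t ht
  -- the line `u` through `p` and the approximating point is mapped to a line through `p` and the
  -- image of that point, which can only be `c`
  obtain ⟨u, hu, hup, hut⟩ : ∃ u, u ≠ 0 ∧ u ⬝ᵥ p = 0 ∧ (q + t • b + z t • a) ⬝ᵥ u = 0 := by
    by_cases h0 : p ⨯₃ (q + t • b + z t • a) = 0
    · obtain ⟨s, hs⟩ := exists_smul_eq_of_cross_eq_zero hp0 h0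
      obtain ⟨u, hu, hup⟩ := exists_dotProduct_eq_zero p
      exact ⟨u, hu, hup, by rw [hs, smul_dotProduct, dotProduct_comm, hup, smul_zero]⟩
    · exact ⟨_, h0, by rw [dotProduct_comm]; exact dot_self_cross _ _, dot_cross_self _ _⟩
  obtain ⟨c', hc', hc'H, hmap⟩ := hinv u hu ((hHp u).mpr hup)
  have hc'p : p ⬝ᵥ c' = 0 := by rw [dotProduct_comm]; exact (hHp c').mp hc'H
  have hXc : evalVec F (q + t • b + z t • a) ⬝ᵥ c = 0 := by
    rw [← eval_pullback]; exact hroot t ha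
  obtain ⟨r, hr⟩ := exists_smul_eq_of_cross_eq_zero hc (cross_cross_eq_zero hqc hXc)
  obtain ⟨r', hr'⟩ := exists_smul_eq_of_cross_eq_zero hc'
    (cross_cross_eq_zero hc'p (hmap _ hut))
  have hr0 : r ≠ 0 := fun h0 => ht (by
    rw [hr, h0, zero_smul])
  have hcc : c = (r⁻¹ * r') • c' := by
    rw [mul_smul, ← hr', hr, smul_smul, inv_mul_cancel₀ hr0, one_smul]
  refine ⟨u, hu, (hHp u).mpr hup, hut, ?_⟩
  change MapsLine F u c
  rw [hcc]
  exact hmap.smul_right _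

theorem Invariant.totallyInvariant (hF : IsNondegenerate F d) (hH : Irreducible H)
    (hk : H.IsHomogeneous k) (hk0 : 0 < k) (hinv : Invariant F H) : TotallyInvariant F H := by
  intro c hc hcH q hq hqc
  by_cases hpencil : ∀ y, eval (evalVec F q ⨯₃ y) H = 0
  · exact mem_liftable_of_forall_cross hF hH hk hinv hq hc hqc hpencil
  · push Not at hpencil
    obtain ⟨y₁, hy₁⟩ := hpencil
    exact mem_liftable_of_eval_cross_ne_zero hF hH hk hk0 hinv hq hc hcH hqc hy₁

/-! ### Total invariance implies invariance -/

/-- The forms `u ↦ F (u × y₁) × F (u × y₂)`: coordinates of the line through the images of two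
points of the line `u`. -/
def lineImage (F : Fin 3 → MvPolynomial (Fin 3) ℂ) (y₁ y₂ : Fin 3 → ℂ) :
    Fin 3 → MvPolynomial (Fin 3) ℂ :=
  (fun i => precompCross y₁ (F i)) ⨯₃ (fun i => precompCross y₂ (F i))

theorem evalVec_lineImage (F : Fin 3 → MvPolynomial (Fin 3) ℂ) (y₁ y₂ u : Fin 3 → ℂ) :
    evalVec (lineImage F y₁ y₂) u = evalVec F (u ⨯₃ y₁) ⨯₃ evalVec F (u ⨯₃ y₂) := by
  refine (eval_cross _ _ u).trans ?_
  simp only [eval_precompCross]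
  rfl

theorem isHomogeneous_lineImage (hF : IsNondegenerate F d) (y₁ y₂ : Fin 3 → ℂ) (i : Fin 3) :
    (lineImage F y₁ y₂ i).IsHomogeneous (d + d) := by
  have h := fun y j => isHomogeneous_precompCross (hF.isHomogeneous j) y
  fin_cases i <;> simp only [lineImage, cross_apply] <;>
    exact ((h _ _).mul (h _ _)).sub ((h _ _).mul (h _ _))

/-- A plane curve has infinitely many points. -/
theorem infinite_zeros (hH : H ≠ 0) (hk : H.IsHomogeneous k) (hk0 : 0 < k) :
    {P : Projectivization ℂ (Fin 3 → ℂ) | eval P.rep H = 0}.Infinite := by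
  obtain ⟨a, ha⟩ : ∃ a, eval a H ≠ 0 := by
    by_contra! h
    exact hH (MvPolynomial.funext fun x => by rw [h, map_zero])
  have ha0 : a ≠ 0 := by
    rintro rfl
    exact ha (by simpa [hk0.ne'] using eval_smul_of_isHomogeneous hk 0 0)
  obtain ⟨u, hu, hua⟩ := exists_dotProduct_eq_zero a
  obtain ⟨q, -, hq⟩ := exists_cross_ne_zero_of_dotProduct_eq_zero hu ha0
    (by rwa [dotProduct_comm])
  obtain ⟨b, hb⟩ := exists_dotProduct_eq_one hq
  choose z hz _ using fun t : ℂ => exists_root_on_line hk hk0 (q + t • b) ha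
  obtain ⟨hne, hinj⟩ := exists_injective_mk hb z
  refine Set.infinite_of_injective_forall_mem hinj fun t => ?_
  obtain ⟨s, -, hs⟩ := exists_smul_of_mk_eq (Projectivization.mk_rep
    (Projectivization.mk ℂ (q + t • b + z t • a) (hne t))).symm
  change eval (Projectivization.rep _) H = 0
  rw [hs, eval_smul_of_isHomogeneous hk, hz, mul_zero]

theorem TotallyInvariant.invariant (hF : IsNondegenerate F d) (hH : Irreducible H)
    (hk : H.IsHomogeneous k) (hk0 : 0 < k) (htot : TotallyInvariant F H) : Invariant F H := by
  let A : Set (Projectivization ℂ (Fin 3 → ℂ)) :=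
    {P | eval P.rep H = 0 ∧ ∃ c, eval c H = 0 ∧ c ≠ 0 ∧ MapsLine F P.rep c}
  -- every line of the web is the image of some line of the web, so infinitely many are mapped
  -- into the web
  have hA : A.Infinite := by
    have hex : ∀ P : Projectivization ℂ (Fin 3 → ℂ), ∃ Q : Projectivization ℂ (Fin 3 → ℂ),
        eval P.rep H = 0 → Q ∈ A ∧ MapsLine F Q.rep P.rep := by
      intro P
      by_cases hP : eval P.rep H = 0
      · obtain ⟨q, hq, -, hqP⟩ := hF.exists_dotProduct_evalVec_eq_zero P.rep_nonzero P.rep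
        obtain ⟨u, hu, huH, -, hmap⟩ := htot _ P.rep_nonzero hP q hq hqP
        obtain ⟨t, ht, hrep⟩ := exists_smul_of_mk_eq
          (Projectivization.mk_rep (Projectivization.mk ℂ u hu)).symm
        have hmap' : MapsLine F (Projectivization.mk ℂ u hu).rep P.rep := by
          rw [hrep]; exact hmap.smul_left ht
        refine ⟨Projectivization.mk ℂ u hu, fun _ => ⟨⟨?_, P.rep, hP, P.rep_nonzero, hmap'⟩, hmap'⟩⟩
        rw [hrep, eval_smul_of_isHomogeneous hk, huH, mul_zero]
      · exact ⟨P, fun h => absurd h hP⟩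
    choose g hg using hex
    refine Set.infinite_of_injOn_mapsTo (f := g) ?_ (fun P hP => (hg P hP).1)
      (infinite_zeros hH.ne_zero hk hk0)
    intro P hP Q hQ hPQ
    have h1 := (hg P hP).2
    rw [hPQ] at h1
    rw [← P.mk_rep, ← Q.mk_rep, Projectivization.mk_eq_mk_iff_crossProduct_eq_zero]
    exact hF.cross_eq_zero_of_mapsLine (Projectivization.rep_nonzero _) h1 (hg Q hQ).2
  -- so a polynomial condition satisfied by such lines holds on all of the curve
  have hdvd : ∀ G : MvPolynomial (Fin 3) ℂ, (∀ P ∈ A, G ∈ lineIdeal P.rep) → H ∣ G := by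
    intro G hG
    by_contra hn
    refine hA ((finite_inter_of_not_dvd hH hn).subset fun P hP => ⟨?_, hG P hP⟩)
    rw [mem_lineIdeal]
    intro t
    rw [eval_smul_of_isHomogeneous hk, hP.1, mul_zero]
  have hparallel : ∀ P ∈ A, ∃ c, eval c H = 0 ∧ c ≠ 0 ∧ ∀ (t : ℂ) (y : Fin 3 → ℂ),
      evalVec F ((t • P.rep) ⨯₃ y) ⬝ᵥ c = 0 := by
    rintro P ⟨-, c, hcH, hc, hmap⟩
    refine ⟨c, hcH, hc, fun t y => hmap _ ?_⟩
    rw [map_smul, LinearMap.smul_apply, smul_dotProduct, dotProduct_comm, dot_self_cross,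
      smul_zero]
  intro u hu huH
  have huG : ∀ G : MvPolynomial (Fin 3) ℂ, (∀ P ∈ A, G ∈ lineIdeal P.rep) → eval u G = 0 := by
    intro G hG
    obtain ⟨D, rfl⟩ := hdvd G hG
    rw [map_mul, huH, zero_mul]
  obtain ⟨x₁, x₂, hx₁, hx₂, hx⟩ := hF.exists_cross_evalVec_ne_zero hu
  obtain ⟨y₁, rfl⟩ := exists_cross_eq_of_dotProduct_eq_zero hu hx₁
  obtain ⟨y₂, rfl⟩ := exists_cross_eq_of_dotProduct_eq_zero hu hx₂
  rw [← evalVec_lineImage] at hx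
  refine ⟨_, hx, ?_, (mapsLine_iff_forall_cross hu).mpr fun y => ?_⟩
  · have h := huG (aeval (lineImage F y₁ y₂) H) fun P hP => ?_
    · rwa [eval_aeval] at h
    · obtain ⟨c, hcH, hc0, hc⟩ := hparallel P hP
      rw [mem_lineIdeal]
      intro t
      rw [eval_aeval]
      change eval (evalVec (lineImage F y₁ y₂) _) H = 0
      rw [evalVec_lineImage]
      obtain ⟨s, hs⟩ := exists_smul_eq_of_cross_eq_zero hc0
        (cross_cross_eq_zero (hc t y₁) (hc t y₂))
      rw [hs, eval_smul_of_isHomogeneous hk, hcH, mul_zero]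
  · have heval : ∀ u, eval u (∑ i, precompCross y (F i) * lineImage F y₁ y₂ i) =
        evalVec F (u ⨯₃ y) ⬝ᵥ evalVec (lineImage F y₁ y₂) u := fun u => by
      simp [dotProduct, eval_precompCross, evalVec]
    rw [← heval]
    refine huG _ fun P hP => ?_
    obtain ⟨c, -, hc0, hc⟩ := hparallel P hP
    rw [mem_lineIdeal]
    intro t
    rw [heval, evalVec_lineImage]
    obtain ⟨s, hs⟩ := exists_smul_eq_of_cross_eq_zero hc0
      (cross_cross_eq_zero (hc t y₁) (hc t y₂))
    rw [hs, dotProduct_smul, hc t y, smul_zero]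

/-! ### Lines contained in plane curves -/

theorem linForm_ne_zero {u : Fin 3 → ℂ} (hu : u ≠ 0) : linForm u ≠ 0 := fun h0 => by
  obtain ⟨w, hw⟩ := exists_dotProduct_eq_one hu
  rw [← eval_linForm, h0, map_zero] at hw
  exact zero_ne_one hw

theorem prime_linForm {u : Fin 3 → ℂ} (hu : u ≠ 0) : Prime (linForm u) := by
  have hne := linForm_ne_zero hu
  refine (irreducible_of_totalDegree_eq_one ((isHomogeneous_linForm u).totalDegree hne)
    fun a ha => ?_).prime
  obtain ⟨m, hm⟩ := ne_zero_iff.mp hne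
  exact isUnit_iff_ne_zero.mpr fun h0 => hm (by simpa [h0] using ha m)

theorem linForm_dvd_iff {u : Fin 3 → ℂ} (hu : u ≠ 0) {G : MvPolynomial (Fin 3) ℂ} :
    linForm u ∣ G ↔ ∀ x, x ⬝ᵥ u = 0 → eval x G = 0 := by
  constructor
  · rintro ⟨D, rfl⟩ x hx
    rw [map_mul, eval_linForm, hx, zero_mul]
  · intro h
    obtain ⟨N, hN⟩ := exists_dvd_pow_of_forall_eval_eq_zero (A := linForm u) (B := G)
      fun x hx => h x (by rwa [eval_linForm] at hx)
    exact (prime_linForm hu).dvd_of_dvd_pow hN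

theorem cross_eq_zero_of_linForm_dvd {u v : Fin 3 → ℂ} (hu : u ≠ 0)
    (h : linForm u ∣ linForm v) : u ⨯₃ v = 0 := by
  rw [← dotProduct_eq_zero_iff]
  intro w
  have h1 := (linForm_dvd_iff hu).mp h (w ⨯₃ u) (by rw [dotProduct_comm]; exact dot_cross_self w u)
  rwa [eval_linForm, dotProduct_comm, triple_product_permutation, dotProduct_comm] at h1

/-- A plane curve contains only finitely many lines. -/
theorem finite_linForm_dvd {G : MvPolynomial (Fin 3) ℂ} (hG : G ≠ 0) :
    {P : Projectivization ℂ (Fin 3 → ℂ) | linForm P.rep ∣ G}.Finite := by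
  classical
  have hsub : {P : Projectivization ℂ (Fin 3 → ℂ) | linForm P.rep ∣ G} ⊆
      ⋃ p ∈ (UniqueFactorizationMonoid.factors G).toFinset,
        {P : Projectivization ℂ (Fin 3 → ℂ) | Associated (linForm P.rep) p} := by
    intro P hP
    obtain ⟨p, hp, hassoc⟩ := UniqueFactorizationMonoid.exists_mem_factors_of_dvd hG
      (prime_linForm P.rep_nonzero).irreducible hP
    exact Set.mem_biUnion (Multiset.mem_toFinset.mpr hp) hassoc
  refine (Set.Finite.biUnion (Finset.finite_toSet _) fun p _ => ?_).subset hsub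
  refine Set.Subsingleton.finite fun P hP Q hQ => ?_
  rw [← P.mk_rep, ← Q.mk_rep, Projectivization.mk_eq_mk_iff_crossProduct_eq_zero]
  exact cross_eq_zero_of_linForm_dvd P.rep_nonzero (hP.trans hQ.symm).dvd

theorem mapsLine_iff_linForm_dvd {u c : Fin 3 → ℂ} (hu : u ≠ 0) :
    MapsLine F u c ↔ linForm u ∣ pullback F c := by
  simp only [linForm_dvd_iff hu, eval_pullback]
  rfl

/-- A line along which the preimage of a line is not reduced is critical. -/
theorem linForm_dvd_jacobianDet {u c : Fin 3 → ℂ} (hu : u ≠ 0) (hc : c ≠ 0)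
    (h : linForm u * linForm u ∣ pullback F c) : linForm u ∣ jacobianDet F := by
  rw [linForm_dvd_iff hu]
  intro q hq
  obtain ⟨D, hD⟩ := h
  rw [eval_jacobianDet, ← Matrix.exists_vecMul_eq_zero_iff]
  refine ⟨c, hc, ?_⟩
  rw [← dotProduct_eq_zero_iff]
  intro v
  rw [← Matrix.dotProduct_mulVec, dotProduct_comm]
  have h1 := eval_derivative_lineRestrict_pullback F c q v 0
  rw [zero_smul, add_zero] at h1
  rw [← h1, hD]
  have h2 : (lineRestrict (linForm u) q v).eval 0 = 0 := by
    rw [eval_lineRestrict, zero_smul, add_zero, eval_linForm, hq]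
  have h3 : lineRestrict (linForm u * linForm u * D) q v =
      lineRestrict (linForm u) q v * lineRestrict (linForm u) q v * lineRestrict D q v := by
    simp only [lineRestrict, map_mul]
  rw [h3]
  simp [Polynomial.derivative_mul, h2]

/-! ### The number of lines of the web over a given line -/

/-- If the preimage of the line `c` of a totally invariant web is reduced, it consists of exactly
`d` lines of the web: its equation and the product of these lines have the same zeros, and both are
squarefree. -/
theorem encard_lines_over (hF : IsNondegenerate F d) (hk : H.IsHomogeneous k)
    (htot : TotallyInvariant F H) {c : Fin 3 → ℂ} (hc : c ≠ 0) (hcH : eval c H = 0)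
    (hred : ∀ P : Projectivization ℂ (Fin 3 → ℂ), eval P.rep H = 0 →
      ¬ linForm P.rep * linForm P.rep ∣ pullback F c) :
    {P : Projectivization ℂ (Fin 3 → ℂ) | eval P.rep H = 0 ∧ MapsLine F P.rep c}.encard = d := by
  have hΦ := hF.pullback_ne_zero hc
  have hfin : {P : Projectivization ℂ (Fin 3 → ℂ) |
      eval P.rep H = 0 ∧ MapsLine F P.rep c}.Finite :=
    (finite_linForm_dvd hΦ).subset fun P hP => (mapsLine_iff_linForm_dvd P.rep_nonzero).mp hP.2
  set s := hfin.toFinset with hs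
  have hmem : ∀ P, P ∈ s ↔ eval P.rep H = 0 ∧ MapsLine F P.rep c := fun P => by simp [hs]
  set L := ∏ P ∈ s, linForm P.rep with hL
  have hLhom : L.IsHomogeneous s.card := by
    simpa using IsHomogeneous.prod s (fun P => linForm P.rep) (fun _ => 1)
      fun P _ => isHomogeneous_linForm P.rep
  have hLne : L ≠ 0 := Finset.prod_ne_zero_iff.mpr fun P _ => linForm_ne_zero P.rep_nonzero
  have h1 : L ∣ pullback F c := by
    refine Finset.prod_dvd_of_isRelPrime (fun P _ Q _ hPQ => ?_) fun P hP =>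
      (mapsLine_iff_linForm_dvd P.rep_nonzero).mp ((hmem P).mp hP).2
    refine ((prime_linForm P.rep_nonzero).irreducible.isRelPrime_iff_not_dvd).mpr fun h => hPQ ?_
    rw [← P.mk_rep, ← Q.mk_rep, Projectivization.mk_eq_mk_iff_crossProduct_eq_zero]
    exact cross_eq_zero_of_linForm_dvd P.rep_nonzero h
  have hlift : ∀ q, q ≠ 0 → eval q (pullback F c) = 0 → eval q L = 0 := by
    intro q hq hqc
    rw [eval_pullback] at hqc
    obtain ⟨u, hu, huH, hqu, hmap⟩ := htot c hc hcH q hq hqc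
    obtain ⟨t, ht, hrep⟩ := exists_smul_of_mk_eq
      (Projectivization.mk_rep (Projectivization.mk ℂ u hu)).symm
    rw [hL, map_prod]
    refine Finset.prod_eq_zero ((hmem (Projectivization.mk ℂ u hu)).mpr ⟨?_, ?_⟩) ?_
    · rw [hrep, eval_smul_of_isHomogeneous hk, huH, mul_zero]
    · rw [hrep]; exact hmap.smul_left ht
    · rw [eval_linForm, hrep, dotProduct_smul, hqu, smul_zero]
  have hpos : 0 < s.card := by
    obtain ⟨q, hq, -, hqc⟩ := hF.exists_dotProduct_evalVec_eq_zero hc c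
    have h := hlift q hq (by rw [eval_pullback, hqc])
    rw [hL, map_prod, Finset.prod_eq_zero_iff] at h
    obtain ⟨P, hP, -⟩ := h
    exact Finset.card_pos.mpr ⟨P, hP⟩
  obtain ⟨N, hN⟩ := exists_dvd_pow_of_forall_eval_eq_zero (A := pullback F c) (B := L)
    fun q hqc => by
      by_cases hq : q = 0
      · have := eval_smul_of_isHomogeneous hLhom 0 0
        rw [hq]
        simpa [hpos.ne'] using this
      · exact hlift q hq hqc
  have hsq : Squarefree (pullback F c) := by
    intro A hA
    by_contra hunit
    have hA0 : A ≠ 0 := by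
      rintro rfl
      rw [mul_zero, zero_dvd_iff] at hA
      exact hΦ hA
    obtain ⟨p, hp, hpA⟩ := WfDvdMonoid.exists_irreducible_factor hunit hA0
    have hpL : p ∣ L := hp.prime.dvd_of_dvd_pow
      ((hpA.trans ((dvd_mul_right A A).trans hA)).trans hN)
    obtain ⟨P, hP, hpP⟩ := hp.prime.exists_mem_finset_dvd hpL
    have hassoc := hp.associated_of_dvd (prime_linForm P.rep_nonzero).irreducible hpP
    exact hred P ((hmem P).mp hP).1
      ((mul_dvd_mul (hassoc.symm.dvd.trans hpA) (hassoc.symm.dvd.trans hpA)).trans hA)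
  have h2 : pullback F c ∣ L := hsq.isRadical N _ hN
  have hdeg : d = s.card := by
    have e1 := (hF.isHomogeneous_pullback c).totalDegree hΦ
    have e2 := hLhom.totalDegree hLne
    have d1 := totalDegree_le_of_dvd_of_isDomain h1 hΦ
    have d2 := totalDegree_le_of_dvd_of_isDomain h2 hLne
    omega
  rw [hfin.encard_eq_coe_toFinset_card, ← hs, hdeg]

/-! ### Rational functions of one variable -/

/-- All but finitely many fibres of the rational function `B / A` have exactly `deg A` points: the
others contain a zero of the Wronskian of `A` and `B`, or lie over `0`. -/
theorem exists_finite_encard_fibre_eq {A B : Polynomial ℂ} {d : ℕ} (hd : 0 < d)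
    (hA : A.natDegree = d) (hB : B.natDegree < d)
    (hAB : ∀ z, A.eval z = 0 → B.eval z ≠ 0) :
    ∃ T : Set ℂ, T.Finite ∧ 0 ∈ T ∧
      ∀ r ∉ T, {z | B.eval z = r * A.eval z}.encard = d := by
  set W := B.derivative * A - B * A.derivative with hW
  have hcop : IsCoprime A B := by
    rw [Polynomial.isCoprime_iff_aeval_ne_zero_of_isAlgClosed ℂ ℂ]
    intro z
    simp only [Polynomial.coe_aeval_eq_eval]
    exact or_iff_not_imp_left.mpr fun h => hAB z (not_not.mp h)
  have hA' : A.derivative ≠ 0 := fun h => by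
    have := Polynomial.derivative_eq_zero.mp h
    omega
  have hW0 : W ≠ 0 := fun h => by
    have h1 : A ∣ B * A.derivative := ⟨B.derivative, by
      rw [mul_comm A]; exact (sub_eq_zero.mp h).symm⟩
    have h2 := Polynomial.natDegree_le_of_dvd (hcop.dvd_of_dvd_mul_left h1) hA'
    have h3 := Polynomial.natDegree_derivative_lt (p := A) (by omega)
    omega
  refine ⟨insert 0 ((fun z => B.eval z / A.eval z) '' {z | W.eval z = 0}),
    Set.Finite.insert 0 (Set.Finite.image _ ?_), Set.mem_insert _ _, fun r hr => ?_⟩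
  · refine W.roots.toFinset.finite_toSet.subset fun z hz => ?_
    simpa [hW0] using hz
  rw [Set.mem_insert_iff, not_or] at hr
  obtain ⟨hr0, hrW⟩ := hr
  set p := B - Polynomial.C r * A with hp
  have hdeg : p.natDegree = d := by
    have h1 : (Polynomial.C r * A).natDegree = d := by
      rw [Polynomial.natDegree_C_mul hr0, hA]
    rw [hp, Polynomial.natDegree_sub_eq_right_of_natDegree_lt (by rwa [h1]), h1]
  have hp0 : p ≠ 0 := fun h => by
    rw [h, Polynomial.natDegree_zero] at hdeg
    omega
  have heval : ∀ z, p.eval z = 0 ↔ B.eval z = r * A.eval z := fun z => by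
    rw [hp, Polynomial.eval_sub, Polynomial.eval_mul, Polynomial.eval_C, sub_eq_zero]
  have hsep : p.Separable := by
    rw [Polynomial.Separable, Polynomial.isCoprime_iff_aeval_ne_zero_of_isAlgClosed ℂ ℂ]
    intro z
    simp only [Polynomial.coe_aeval_eq_eval]
    refine or_iff_not_imp_left.mpr fun hz h2 => ?_
    have h1 := (heval z).mp (not_not.mp hz)
    rw [hp, Polynomial.derivative_sub, Polynomial.derivative_C_mul, Polynomial.eval_sub,
      Polynomial.eval_mul, Polynomial.eval_C, sub_eq_zero] at h2
    have hAz : A.eval z ≠ 0 := fun h => hAB z h (by rw [h1, h, mul_zero])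
    refine hrW ⟨z, ?_, ?_⟩
    · change W.eval z = 0
      rw [hW, Polynomial.eval_sub, Polynomial.eval_mul, Polynomial.eval_mul, h1, h2]
      ring
    · change B.eval z / A.eval z = r
      rw [h1, mul_div_assoc, div_self hAz, mul_one]
  have hset : {z | B.eval z = r * A.eval z} = p.roots.toFinset := by
    ext z
    simp [hp0, ← heval, Polynomial.IsRoot]
  rw [hset, Set.encard_coe_eq_coe_finsetCard, Multiset.toFinset_card_of_nodup
    (Polynomial.nodup_roots hsep), ← (IsAlgClosed.splits p).natDegree_eq_card_roots, hdeg]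

/-! ### The degree of the map on a line -/

/-- The points of a line other than `a` are parametrized by `z ↦ b + z a`. -/
theorem exists_injective_mk_line {a b : Fin 3 → ℂ} (h : a ⨯₃ b ≠ 0) :
    ∃ hne : ∀ z : ℂ, b + z • a ≠ 0,
      Function.Injective fun z => Projectivization.mk ℂ (b + z • a) (hne z) := by
  have h1 : ∀ z : ℂ, a ⨯₃ (b + z • a) = a ⨯₃ b := fun z => by
    rw [map_add, cross_smul_self, add_zero]
  refine ⟨fun z h0 => h (by rw [← h1 z, h0, map_zero]), fun y z hyz => ?_⟩
  obtain ⟨r, -, hr⟩ := exists_smul_of_mk_eq hyz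
  have h2 := congrArg (a ⨯₃ ·) hr
  simp only [map_smul, h1] at h2
  have hr1 : r = 1 := by
    have h3 : (r - 1) • (a ⨯₃ b) = 0 := by rw [sub_smul, one_smul, ← h2, sub_self]
    exact sub_eq_zero.mp ((smul_eq_zero.mp h3).resolve_right h)
  rw [hr1, one_smul, add_right_inj] at hr
  have ha : a ≠ 0 := by
    rintro rfl
    exact h (by rw [map_zero, LinearMap.zero_apply])
  have h3 : (z - y) • a = 0 := by rw [sub_smul, hr, sub_self]
  exact (sub_eq_zero.mp ((smul_eq_zero.mp h3).resolve_right ha)).symm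

theorem infinite_dualLine (c : DualPlane) : (dualLine c).Infinite := by
  induction c using Projectivization.ind with | h c hc =>
  obtain ⟨a, ha, hac⟩ := exists_dotProduct_eq_zero c
  obtain ⟨b, hbc, hab⟩ := exists_cross_ne_zero_of_dotProduct_eq_zero hc ha hac
  obtain ⟨hne, hinj⟩ := exists_injective_mk_line hab
  refine Set.infinite_of_injective_forall_mem hinj fun z => ?_
  change (b + z • a) ⬝ᵥ c = 0
  rw [add_dotProduct, smul_dotProduct, hac, hbc, smul_zero, add_zero]

/-- `f` is induced by the triple of forms `F`. -/
def IsInducedBy (f : Plane → Plane) (F : Fin 3 → MvPolynomial (Fin 3) ℂ) : Prop :=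
  ∀ (x : Fin 3 → ℂ) (hx : x ≠ 0), ∃ hy : evalVec F x ≠ 0,
    f (Projectivization.mk ℂ x hx) = Projectivization.mk ℂ (evalVec F x) hy

variable {f : Plane → Plane}

theorem image_dualLine_subset_iff (hf : IsInducedBy f F) (hF : IsNondegenerate F d)
    {u c : Fin 3 → ℂ} (hu : u ≠ 0) (hc : c ≠ 0) :
    f '' dualLine (Projectivization.mk ℂ u hu) ⊆ dualLine (Projectivization.mk ℂ c hc) ↔
      MapsLine F u c := by
  constructor
  · intro h x hx
    by_cases hx0 : x = 0
    · have : evalVec F x = 0 := by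
        rw [hx0]; simpa [hF.pos.ne'] using hF.evalVec_smul 0 0
      rw [this, zero_dotProduct]
    · obtain ⟨hy, hfx⟩ := hf x hx0
      have h1 : f (Projectivization.mk ℂ x hx0) ∈ dualLine (Projectivization.mk ℂ c hc) :=
        h ⟨_, hx, rfl⟩
      rw [hfx] at h1
      exact h1
  · rintro h _ ⟨P, hP, rfl⟩
    induction P using Projectivization.ind with | h x hx =>
    obtain ⟨hy, hfx⟩ := hf x hx
    rw [hfx]
    exact h x hP

theorem image_dualLine_eq_iff (hf : IsInducedBy f F) (hF : IsNondegenerate F d)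
    {u c : Fin 3 → ℂ} (hu : u ≠ 0) (hc : c ≠ 0) :
    f '' dualLine (Projectivization.mk ℂ u hu) = dualLine (Projectivization.mk ℂ c hc) ↔
      MapsLine F u c := by
  rw [← image_dualLine_subset_iff hf hF hu hc]
  refine ⟨fun h => h.subset, fun h => h.antisymm fun P hP => ?_⟩
  rw [image_dualLine_subset_iff hf hF] at h
  induction P using Projectivization.ind with | h y hy =>
  obtain ⟨x, hx, hxu, hxy⟩ := hF.exists_cross_evalVec_eq_zero hu hc h hP
  obtain ⟨hFx, hfx⟩ := hf x hx
  refine ⟨Projectivization.mk ℂ x hx, hxu, ?_⟩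
  rw [hfx, Projectivization.mk_eq_mk_iff_crossProduct_eq_zero]
  exact hxy

/-- The restriction of `f` to a line that is mapped into a line has topological degree `d`. -/
theorem hasTopologicalDegree_imageFactorization (hf : IsInducedBy f F) (hF : IsNondegenerate F d)
    {u c : Fin 3 → ℂ} (hu : u ≠ 0) (hc : c ≠ 0) (hmap : MapsLine F u c) :
    HasTopologicalDegree
      (Set.imageFactorization f (dualLine (Projectivization.mk ℂ u hu))) d := by
  have himage := (image_dualLine_eq_iff hf hF hu hc).mpr hmap
  obtain ⟨a, ha, hau⟩ := exists_dotProduct_eq_zero u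
  obtain ⟨b, hbu, hab⟩ := exists_cross_ne_zero_of_dotProduct_eq_zero hu ha hau
  obtain ⟨hne, hinj⟩ := exists_injective_mk_line hab
  have hline : ∀ z : ℂ, (b + z • a) ⬝ᵥ u = 0 := fun z => by
    rw [add_dotProduct, smul_dotProduct, hau, hbu, smul_zero, add_zero]
  -- coordinates `e₁`, `e₂` on the plane orthogonal to `c` in which `F a` is `(1, 0)`
  set p := evalVec F a with hp
  have hp0 : p ≠ 0 := hF.evalVec_ne_zero a ha
  have hpc : p ⬝ᵥ c = 0 := hmap a hau
  obtain ⟨e₁, he₁⟩ := exists_dotProduct_eq_one hp0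
  rw [dotProduct_comm] at he₁
  obtain ⟨w, hw⟩ := exists_dotProduct_eq_one hc
  set e₂ := p ⨯₃ w with he₂
  have he₂p : p ⬝ᵥ e₂ = 0 := dot_self_cross p w
  have hzero : ∀ y, y ⬝ᵥ c = 0 → y ⬝ᵥ e₁ = 0 → y ⬝ᵥ e₂ = 0 → y = 0 := by
    intro y hyc h1 h2
    obtain ⟨t, ht⟩ := exists_smul_eq_of_cross_eq_zero hc (cross_cross_eq_zero hyc hpc)
    rw [he₂, triple_product_permutation, triple_product_permutation, ht, dotProduct_smul, hw,
      smul_eq_mul, mul_one] at h2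
    rw [h2, zero_smul, ← cross_anticomm, neg_eq_zero] at ht
    obtain ⟨s, rfl⟩ := exists_smul_eq_of_cross_eq_zero hp0 ht
    rw [smul_dotProduct, he₁, smul_eq_mul, mul_one] at h1
    rw [h1, zero_smul]
  have hpar : ∀ y y', y ⬝ᵥ c = 0 → y' ⬝ᵥ c = 0 → y ≠ 0 →
      (y ⬝ᵥ e₁) * (y' ⬝ᵥ e₂) = (y ⬝ᵥ e₂) * (y' ⬝ᵥ e₁) → y ⨯₃ y' = 0 := by
    intro y y' hy hy' hy0 h
    have hcomb : ∀ i, (y ⬝ᵥ i) • y' - (y' ⬝ᵥ i) • y = 0 → y ⬝ᵥ i ≠ 0 → y ⨯₃ y' = 0 := by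
      intro i hi hyi
      have h1 := congrArg (y ⨯₃ ·) hi
      simp only [map_sub, map_smul, cross_self, smul_zero, sub_zero, map_zero] at h1
      exact (smul_eq_zero.mp h1).resolve_left hyi
    by_cases h1 : y ⬝ᵥ e₁ = 0
    · have h2 : y ⬝ᵥ e₂ ≠ 0 := fun h2 => hy0 (hzero y hy h1 h2)
      refine hcomb e₂ (hzero _ ?_ ?_ ?_) h2 <;>
        simp only [sub_dotProduct, smul_dotProduct, smul_eq_mul, hy, hy']
      exacts [by ring, by linear_combination -h, by ring]
    · refine hcomb e₁ (hzero _ ?_ ?_ ?_) h1 <;>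
        simp only [sub_dotProduct, smul_dotProduct, smul_eq_mul, hy, hy']
      exacts [by ring, by ring, by linear_combination h]
  have hcoeff := natDegree_lineRestrict_le_and_coeff (hF.isHomogeneous_pullback e₁) b a
  have hcoeff₂ := natDegree_lineRestrict_le_and_coeff (hF.isHomogeneous_pullback e₂) b a
  rw [eval_pullback, ← hp] at hcoeff hcoeff₂
  set A := lineRestrict (pullback F e₁) b a with hA
  set B := lineRestrict (pullback F e₂) b a with hB
  have hAz : ∀ z, A.eval z = evalVec F (b + z • a) ⬝ᵥ e₁ := fun z => by
    rw [hA, eval_lineRestrict, eval_pullback]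
  have hBz : ∀ z, B.eval z = evalVec F (b + z • a) ⬝ᵥ e₂ := fun z => by
    rw [hB, eval_lineRestrict, eval_pullback]
  have hAdeg : A.natDegree = d := le_antisymm hcoeff.1
    (Polynomial.le_natDegree_of_ne_zero (by rw [hcoeff.2, he₁]; exact one_ne_zero))
  have hBdeg : B.natDegree < d := by
    refine lt_of_le_of_ne hcoeff₂.1 fun h => ?_
    have h0 : B.leadingCoeff = 0 := by rw [Polynomial.leadingCoeff, h, hcoeff₂.2, he₂p]
    rw [Polynomial.leadingCoeff_eq_zero] at h0
    rw [h0, Polynomial.natDegree_zero] at h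
    exact hF.pos.ne h
  obtain ⟨T, hT, hT0, hfib⟩ := exists_finite_encard_fibre_eq hF.pos hAdeg hBdeg fun z h1 h2 =>
    hF.evalVec_ne_zero _ (hne z) (hzero _ (hmap _ (hline z)) (by rw [← hAz, h1])
      (by rw [← hBz, h2]))
  -- `T` contains the slopes `e₂ / e₁` of the exceptional image points and the slope `0` of the image
  -- of `a`, the one point missed by the parametrization
  let S : Set (f '' dualLine (Projectivization.mk ℂ u hu)) :=
    {y | y.1.rep ⬝ᵥ e₁ = 0} ∪ {y | y.1.rep ⬝ᵥ e₁ ≠ 0 ∧ (y.1.rep ⬝ᵥ e₂) / (y.1.rep ⬝ᵥ e₁) ∈ T}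
  have hrep : ∀ y : f '' dualLine (Projectivization.mk ℂ u hu), y.1.rep ⬝ᵥ c = 0 := by
    rintro ⟨y, hy⟩
    rw [himage] at hy
    rw [← y.mk_rep] at hy
    exact hy
  have heq : ∀ y y' : f '' dualLine (Projectivization.mk ℂ u hu),
      (y.1.rep ⬝ᵥ e₁) * (y'.1.rep ⬝ᵥ e₂) = (y.1.rep ⬝ᵥ e₂) * (y'.1.rep ⬝ᵥ e₁) → y = y' := by
    intro y y' h
    apply Subtype.ext
    rw [← y.1.mk_rep, ← y'.1.mk_rep, Projectivization.mk_eq_mk_iff_crossProduct_eq_zero]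
    exact hpar _ _ (hrep y) (hrep y') y.1.rep_nonzero h
  refine ⟨S, Set.Finite.union ?_ ?_, fun y hy => ?_⟩
  · refine Set.Subsingleton.finite fun y hy y' hy' => heq y y' ?_
    rw [Set.mem_ofPred_eq] at hy hy'
    rw [hy, hy', zero_mul, mul_zero]
  · refine Set.Finite.of_finite_image
      (f := fun y => (y.1.rep ⬝ᵥ e₂) / (y.1.rep ⬝ᵥ e₁)) (hT.subset ?_) ?_
    · rintro _ ⟨y, hy, rfl⟩
      exact hy.2
    · intro y hy y' hy' h
      refine heq y y' ?_
      have := (div_eq_div_iff hy.1 hy'.1).mp h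
      linear_combination -this
  · have hy1 : y.1.rep ⬝ᵥ e₁ ≠ 0 := fun h => hy (Or.inl h)
    have hyT : (y.1.rep ⬝ᵥ e₂) / (y.1.rep ⬝ᵥ e₁) ∉ T := fun h => hy (Or.inr ⟨hy1, h⟩)
    have hparam : Subtype.val '' (Set.imageFactorization f
        (dualLine (Projectivization.mk ℂ u hu)) ⁻¹' {y}) =
        (fun z => Projectivization.mk ℂ (b + z • a) (hne z)) ''
          {z | B.eval z = (y.1.rep ⬝ᵥ e₂) / (y.1.rep ⬝ᵥ e₁) * A.eval z} := by
      ext P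
      constructor
      · rintro ⟨⟨P, hP⟩, hPy, rfl⟩
        have hfP : f P = y.1 := congrArg Subtype.val hPy
        induction P using Projectivization.ind with | h x hx =>
        obtain ⟨hFx, hfx⟩ := hf x hx
        have hxu : x ⬝ᵥ u = 0 := hP
        rw [hfx] at hfP
        obtain ⟨s, -, hs⟩ := exists_smul_of_mk_eq (hfP.trans y.1.mk_rep.symm)
        obtain ⟨t, ht⟩ := exists_smul_eq_of_cross_eq_zero hu (cross_cross_eq_zero hau hbu)
        obtain ⟨t', ht'⟩ := exists_smul_eq_of_cross_eq_zero hu (cross_cross_eq_zero hau hxu)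
        have ht0 : t ≠ 0 := fun h => hab (by rw [ht, h, zero_smul])
        -- `x` is a combination of `a` and `b`
        obtain ⟨α, hα⟩ := exists_smul_eq_of_cross_eq_zero (v := x - (t' / t) • b) ha (by
          rw [map_sub, map_smul, ht, ht', smul_smul, div_mul_cancel₀ _ ht0, sub_self])
        have hx' : x = (t' / t) • b + α • a := by rw [← hα]; abel
        have hβ : t' / t ≠ 0 := by
          intro h0
          refine hyT ?_
          rw [h0, zero_smul, zero_add] at hx'
          rw [hs, hx', hF.evalVec_smul, smul_dotProduct, smul_dotProduct, ← hp, he₂p, smul_zero,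
            smul_zero, zero_div]
          exact hT0
        have hxz : x = (t' / t) • (b + (α / (t' / t)) • a) := by
          rw [smul_add, smul_smul, mul_div_cancel₀ _ hβ, ← hx']
        refine ⟨α / (t' / t), ?_, ?_⟩
        · change B.eval _ = _ * A.eval _
          rw [hxz, hF.evalVec_smul] at hs
          rw [div_mul_eq_mul_div, eq_div_iff hy1, hAz, hBz, hs]
          simp only [smul_dotProduct, smul_eq_mul]
          ring
        · rw [Projectivization.mk_eq_mk_iff_crossProduct_eq_zero]
          conv_lhs => rw [hxz]
          exact cross_smul_self _ _
      · rintro ⟨z, hz, rfl⟩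
        refine ⟨⟨_, hline z⟩, ?_, rfl⟩
        apply Subtype.ext
        obtain ⟨hFx, hfx⟩ := hf _ (hne z)
        change f (Projectivization.mk ℂ (b + z • a) (hne z)) = y.1
        rw [hfx]
        conv_rhs => rw [← y.1.mk_rep]
        rw [Projectivization.mk_eq_mk_iff_crossProduct_eq_zero]
        refine hpar _ _ (hmap _ (hline z)) (hrep y) hFx ?_
        have hz' : B.eval z = (y.1.rep ⬝ᵥ e₂) / (y.1.rep ⬝ᵥ e₁) * A.eval z := hz
        rw [← hAz, ← hBz, hz']
        field_simp
    rw [← Subtype.val_injective.encard_image, hparam, hinj.encard_image]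
    exact hfib _ hyT

variable {C : Set DualPlane}

/-! ### From coordinates to the projective plane -/

/-- `C` is the set of projective zeros of the polynomial `H`. -/
def IsZeroLocus (C : Set (Projectivization ℂ (Fin 3 → ℂ))) (H : MvPolynomial (Fin 3) ℂ) : Prop :=
  ∀ (x : Fin 3 → ℂ) (hx : x ≠ 0), Projectivization.mk ℂ x hx ∈ C ↔ eval x H = 0

theorem IsZeroLocus.mem_iff (hC : IsZeroLocus C H) (P : Projectivization ℂ (Fin 3 → ℂ)) :
    P ∈ C ↔ eval P.rep H = 0 := by
  conv_lhs => rw [← P.mk_rep]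
  exact hC _ P.rep_nonzero

theorem webInvariant_iff (hf : IsInducedBy f F) (hF : IsNondegenerate F d)
    (hC : IsZeroLocus C H) : WebInvariant f C ↔ Invariant F H := by
  constructor
  · intro h u hu huH
    obtain ⟨c', hc', himage⟩ := h _ ((hC u hu).mpr huH)
    induction c' using Projectivization.ind with | h c hc =>
    exact ⟨c, hc, (hC c hc).mp hc', (image_dualLine_eq_iff hf hF hu hc).mp himage⟩
  · intro h c hcC
    induction c using Projectivization.ind with | h u hu =>
    obtain ⟨c, hc, hcH, hmap⟩ := h u hu ((hC u hu).mp hcC)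
    exact ⟨_, (hC c hc).mpr hcH, (image_dualLine_eq_iff hf hF hu hc).mpr hmap⟩

theorem webTotallyInvariant_iff (hf : IsInducedBy f F) (hF : IsNondegenerate F d)
    (hC : IsZeroLocus C H) : WebTotallyInvariant f C ↔ TotallyInvariant F H := by
  constructor
  · intro h c hc hcH q hq hqc
    obtain ⟨S, hSC, hS⟩ := h _ ((hC c hc).mpr hcH)
    obtain ⟨hFq, hfq⟩ := hf q hq
    have hmem : Projectivization.mk ℂ q hq ∈ f ⁻¹' dualLine (Projectivization.mk ℂ c hc) := by
      rw [Set.mem_preimage, hfq]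
      exact hqc
    rw [hS, Set.mem_iUnion₂] at hmem
    obtain ⟨s, hs, hqs⟩ := hmem
    induction s using Projectivization.ind with | h u hu =>
    refine ⟨u, hu, (hC u hu).mp (hSC hs), hqs, ?_⟩
    rw [← image_dualLine_subset_iff hf hF hu hc, Set.image_subset_iff, hS]
    exact Set.subset_biUnion_of_mem hs
  · intro h c hcC
    refine ⟨{s | s ∈ C ∧ dualLine s ⊆ f ⁻¹' dualLine c}, fun s hs => hs.1,
      Set.Subset.antisymm (fun P hP => ?_) (Set.iUnion₂_subset fun s hs => hs.2)⟩
    induction c using Projectivization.ind with | h c hc =>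
    induction P using Projectivization.ind with | h q hq =>
    obtain ⟨hFq, hfq⟩ := hf q hq
    rw [Set.mem_preimage, hfq] at hP
    obtain ⟨u, hu, huH, hqu, hmap⟩ := h c hc ((hC c hc).mp hcC) q hq hP
    refine Set.mem_biUnion (x := Projectivization.mk ℂ u hu) ⟨(hC u hu).mpr huH, ?_⟩ hqu
    rw [← Set.image_subset_iff, image_dualLine_subset_iff hf hF hu hc]
    exact hmap

theorem mapsLine_inducedMap (hf : IsInducedBy f F) (hF : IsNondegenerate F d)
    (h : WebInvariant f C) (c : C) : MapsLine F c.1.rep (inducedMap h c).1.rep := by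
  rw [← image_dualLine_eq_iff hf hF (Projectivization.rep_nonzero _)
    (Projectivization.rep_nonzero _), Projectivization.mk_rep, Projectivization.mk_rep]
  exact image_dualLine h c

theorem inducedMap_eq_iff (hf : IsInducedBy f F) (hF : IsNondegenerate F d)
    (h : WebInvariant f C) (c y : C) :
    inducedMap h c = y ↔ MapsLine F c.1.rep y.1.rep := by
  refine ⟨fun hy => hy ▸ mapsLine_inducedMap hf hF h c, fun hmap => Subtype.ext ?_⟩
  rw [← (inducedMap h c).1.mk_rep, ← y.1.mk_rep,
    Projectivization.mk_eq_mk_iff_crossProduct_eq_zero]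
  exact hF.cross_eq_zero_of_mapsLine c.1.rep_nonzero (mapsLine_inducedMap hf hF h c) hmap

/-- Near any point of `C` the induced map is `u ↦ F (u × y₁) × F (u × y₂)` for suitable `y₁`,
`y₂`. -/
theorem isRegularMap_inducedMap (hf : IsInducedBy f F) (hF : IsNondegenerate F d)
    (h : WebInvariant f C) : IsRegularMap (inducedMap h) := by
  intro c₀
  have hu := c₀.1.rep_nonzero
  obtain ⟨x₁, x₂, hx₁, hx₂, hx⟩ := hF.exists_cross_evalVec_ne_zero hu
  obtain ⟨y₁, rfl⟩ := exists_cross_eq_of_dotProduct_eq_zero hu hx₁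
  obtain ⟨y₂, rfl⟩ := exists_cross_eq_of_dotProduct_eq_zero hu hx₂
  rw [← evalVec_lineImage] at hx
  refine ⟨lineImage F y₁ y₂, d + d, isHomogeneous_lineImage hF y₁ y₂, ?_, ?_⟩
  · intro x hx0 hxc h0
    obtain ⟨t, -, ht⟩ := exists_smul_of_mk_eq (hxc.trans c₀.1.mk_rep.symm)
    refine hx (funext fun i => ?_)
    change eval _ (lineImage F y₁ y₂ i) = 0
    rw [ht, eval_smul_of_isHomogeneous (isHomogeneous_lineImage hF y₁ y₂ i)]
    have : eval x (lineImage F y₁ y₂ i) = 0 := congrFun h0 i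
    rw [this, mul_zero]
  · intro c x hx0 hxc hy
    obtain ⟨t, ht0, ht⟩ := exists_smul_of_mk_eq (c.1.mk_rep.trans hxc.symm)
    have hmap := (mapsLine_inducedMap hf hF h c).smul_left ht0
    rw [← ht, mapsLine_iff_forall_cross hx0] at hmap
    conv_lhs => rw [← (inducedMap h c).1.mk_rep]
    rw [Projectivization.mk_eq_mk_iff_crossProduct_eq_zero, evalVec_lineImage]
    exact cross_cross_eq_zero (hmap y₁) (hmap y₂)

/-- The induced map has exactly `d` preimages over every point whose line does not have a critical
line of the web in its preimage. -/
theorem hasTopologicalDegree_inducedMap (hf : IsInducedBy f F) (hF : IsNondegenerate F d)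
    (hk : H.IsHomogeneous k) (hC : IsZeroLocus C H) (htot : TotallyInvariant F H)
    (h : WebInvariant f C) : HasTopologicalDegree (inducedMap h) d := by
  have hfin := finite_linForm_dvd hF.jacobianDet_ne_zero
  refine ⟨inducedMap h '' (Subtype.val ⁻¹'
    {P : Projectivization ℂ (Fin 3 → ℂ) | linForm P.rep ∣ jacobianDet F}),
    (hfin.preimage Subtype.val_injective.injOn).image _, fun y hy => ?_⟩
  have hyH : eval y.1.rep H = 0 := (hC.mem_iff y.1).mp y.2
  rw [← encard_lines_over hF hk htot y.1.rep_nonzero hyH fun P hP hdvd => ?_,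
    ← Subtype.val_injective.encard_image]
  · congr 1
    ext P
    constructor
    · rintro ⟨c, hc, rfl⟩
      exact ⟨(hC.mem_iff c.1).mp c.2, (inducedMap_eq_iff hf hF h c y).mp hc⟩
    · rintro ⟨hP, hmap⟩
      exact ⟨⟨P, (hC.mem_iff P).mpr hP⟩, (inducedMap_eq_iff hf hF h _ y).mpr hmap, rfl⟩
  · refine hy ⟨⟨P, (hC.mem_iff P).mpr hP⟩,
      linForm_dvd_jacobianDet P.rep_nonzero y.1.rep_nonzero hdvd, ?_⟩
    rw [inducedMap_eq_iff hf hF, mapsLine_iff_linForm_dvd P.rep_nonzero]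
    exact (dvd_mul_right _ _).trans hdvd

/-! ### The pushforward of a line -/

theorem topologicalDegree_eq {X Y : Set (Projectivization ℂ (Fin 3 → ℂ))} {g : X → Y} {n : ℕ}
    (hY : Y.Infinite) (hg : HasTopologicalDegree g n) : topologicalDegree g = n := by
  have huniq : {m | HasTopologicalDegree g m} = {n} := by
    ext m
    refine ⟨fun ⟨S, hS, hSm⟩ => ?_, fun hm => ?_⟩
    · obtain ⟨S', hS', hSn⟩ := hg
      have := hY.to_subtype
      obtain ⟨y, hy⟩ := (hS.union hS').infinite_compl.nonempty
      rw [Set.mem_compl_iff, Set.mem_union, not_or] at hy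
      have := (hSm y hy.1).symm.trans (hSn y hy.2)
      exact_mod_cast this
    · rw [Set.mem_singleton_iff] at hm
      rw [hm]
      exact hg
  rw [topologicalDegree, huniq, csInf_singleton]

theorem pushforward_lineDivisor (hf : IsInducedBy f F) (hF : IsNondegenerate F d)
    {c c' : DualPlane} (h : f '' dualLine c = dualLine c') :
    pushforward f (lineDivisor c) = d • lineDivisor c' := by
  have hdeg : topologicalDegree (Set.imageFactorization f (dualLine c)) = d := by
    refine topologicalDegree_eq (by rw [h]; exact infinite_dualLine c') ?_
    induction c using Projectivization.ind with | h u hu =>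
    induction c' using Projectivization.ind with | h v hv =>
    exact hasTopologicalDegree_imageFactorization hf hF hu hv
      ((image_dualLine_eq_iff hf hF hu hv).mp h)
  have hcurve : IsIrreducibleCurve (f '' dualLine c) := h ▸ isIrreducibleCurve_dualLine c'
  have hprime : (⟨f '' dualLine c, hcurve⟩ : PrimeDivisor) =
      ⟨dualLine c', isIrreducibleCurve_dualLine c'⟩ := Subtype.ext h
  have hsingle : ∀ V : PrimeDivisor, pushforward f (Finsupp.single V 1) = pushforwardPrime f V :=
    fun V => by
      rw [pushforward, Finsupp.liftAddHom_apply_single, zmultiplesHom_apply, one_zsmul]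
  have hsmul : ∀ V : PrimeDivisor, (Finsupp.single V (d : ℤ) : Divisor) = d • Finsupp.single V 1 :=
    fun V => by rw [Finsupp.smul_single, nsmul_eq_mul, mul_one]
  refine (hsingle ⟨dualLine c, isIrreducibleCurve_dualLine c⟩).trans ?_
  refine (dif_pos hcurve).trans ?_
  rw [hprime, hdeg]
  exact hsmul _

end PlaneWeb

end

theorem mainTheorem3 (d : ℕ) (hd : 2 ≤ d)
    (f : PlaneWeb.Plane → PlaneWeb.Plane) (hf : PlaneWeb.IsHolomorphicOfDegree f d)
    (C : Set PlaneWeb.DualPlane) (hC : PlaneWeb.IsIrreducibleCurve C) :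
    (PlaneWeb.WebInvariant f C ↔ PlaneWeb.WebTotallyInvariant f C) ∧
    ∀ h : PlaneWeb.WebInvariant f C,
      PlaneWeb.IsRegularMap (PlaneWeb.inducedMap h) ∧
      PlaneWeb.HasTopologicalDegree (PlaneWeb.inducedMap h) d ∧
      ∀ c : C, PlaneWeb.pushforward f (PlaneWeb.lineDivisor c) =
        d • PlaneWeb.lineDivisor (PlaneWeb.inducedMap h c) := by
  obtain ⟨F, hhom, hf⟩ := hf
  obtain ⟨H, k, hk, hH, hC⟩ := hC
  have hF : PlaneWeb.IsNondegenerate F d :=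
    ⟨hhom, fun x hx => (hf x hx).1, by omega⟩
  have hk0 : 0 < k := by
    refine Nat.pos_of_ne_zero fun h0 => hH.not_isUnit ?_
    rw [h0, ← MvPolynomial.totalDegree_zero_iff_isHomogeneous,
      MvPolynomial.totalDegree_eq_zero_iff_eq_C] at hk
    rw [hk]
    refine (isUnit_iff_ne_zero.mpr fun h1 => hH.ne_zero ?_).map MvPolynomial.C
    rw [hk, h1, map_zero]
  have hinv := PlaneWeb.webInvariant_iff hf hF hC
  refine ⟨?_, fun h => ⟨PlaneWeb.isRegularMap_inducedMap hf hF h, ?_, fun c => ?_⟩⟩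
  · rw [hinv, PlaneWeb.webTotallyInvariant_iff hf hF hC]
    exact ⟨fun h => h.totallyInvariant hF hH hk hk0, fun h => h.invariant hF hH hk hk0⟩
  · exact PlaneWeb.hasTopologicalDegree_inducedMap hf hF hk hC
      ((hinv.mp h).totallyInvariant hF hH hk hk0) h
  · exact PlaneWeb.pushforward_lineDivisor hf hF (PlaneWeb.image_dualLine h c)
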